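/- Let $d\ge 2$ and write $x=(\tilde x,x_d)\in[0,1]^{d-1}\times[0,1]$. A classification problem is a pair $(\mathbb P_X,\eta)$ of a probability measure $\mathbb P_X$ on $[0,1]^d$ and a measurable function $\eta:[0,1]^d\to[0,1]$, with $\mathbb P(Y=1\mid X=x)=\eta(x)$, $Y\in\{0,1\}$. Put $f^*=\mathbf 1\{\eta\ge 1/2\}$, $R(f)=\mathbb P(Y\ne f(X))$ and $\mathcal E(f)=R(f)-R(f^*)$. For $\beta>0$ let $\lfloor\beta\rfloor$ be the largest integer strictly smaller than $\beta$. For $\lambda\ge1$ and $\alpha>0$, $\Sigma(\lambda,\alpha)$ is the set of functions $g:[0,1]^{d-1}\to[0,1]$ that are $\lfloor\alpha\rfloor$ times continuously differentiable and satisfy $|g(x)-\mathrm{TP}_{y,\lfloor\beta\rfloor}(x)|\le\lambda\|x-y\|_\infty^\beta$ for all $x,y\in[0,1]^{d-1}$ and all $0<\beta\le\alpha$, where $\mathrm{TP}_{y,k}$ is the Taylor polynomial of $g$ of degree $k$ at $y$. Let $\lambda\ge 1$, $\alpha>0$, $\kappa>1$, $\kappa'>\kappa-1$, $c>0$, $C_3>0$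 and $0<\Delta_0<1$, with $c\,\max(1/2,\Delta_0)^{\kappa-1}<1/2$ (which always holds if $c\le 1/2$). Let $\mathcal P(\alpha,\kappa,\kappa')$ be the set of classification problems for which there is $g^*\in\Sigma(\lambda,\alpha)$ such that 1. $\{x:\eta(x)\ge 1/2\}=\{x: x_d\ge g^*(\tilde x)\}$; 2. $|\eta(x)-1/2|\ge c\,|x_d-g^*(\tilde x)|^{\kappa-1}$ for all $x\in[0,1]^d$; 3. $\int_{\{x:\,|x_d-g^*(\tilde x)|\le\Delta\}}|1-2\eta(x)|\,d\mathbb P_X(x)\le C_3\Delta^{\kappa'}$ for all $\Delta\in[0,\Delta_0]$. An active strategy $\mathcal A_n$ with budget $n$ sequentially chooses points $x_1,\dots,x_n\in[0,1]^d$, where $x_t$ may depend on the marginal $\mathbb P_X$, on internal randomness and on the points and labels observed before; it receives at each $x_t$ a label drawn from $\mathbb P_{Y\mid X=x_t}$, and finally returns a classifier $\widehat f_n:[0,1]^d\to\{0,1\}$ that depends on the same information. Then there are a constant $C>0$ that does not depend on $n$ and an integer $N$ such that for all $n\ge N$ $$ \inf_{\mathcal A_n}\ \sup_{(\mathbb P_X,\eta)\in\mathcal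 P(\alpha,\kappa,\kappa')}\ \mathbb E\big[\mathcal E(\widehat f_n)\big]\ \ge\ C\,n^{-\alpha\kappa'/(2\alpha(\kappa-1)+d-1)} . $$ -/

import Mathlib

open MeasureTheory ProbabilityTheory Set
open scoped ENNReal

universe u

namespace ActiveLearning

noncomputable section

/-- The feature space `[0,1]^d`, written as `[0,1]^(d-1) × [0,1]`: a point is
`x = (x̃, x_d)`. -/
abbrev Feature (d : ℕ) : Type := (Fin (d - 1) → unitInterval) × unitInterval

/-- The first `d - 1` coordinates `x̃` of a point, as a real vector. -/
def Feature.tilde {d : ℕ} (x : Feature d) : Fin (d - 1) → ℝ := fun i => (x.1 i : ℝ)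

/-- The last coordinate `x_d` of a point, as a real number. -/
def Feature.last {d : ℕ} (x : Feature d) : ℝ := (x.2 : ℝ)

/-! ### Hölder classes and epigraphs -/

/-- For `a > 0`, the largest integer strictly smaller than `a`. -/
def strictFloor (a : ℝ) : ℕ := ⌈a⌉₊ - 1

/-- The Taylor polynomial of degree `k` of `g` at `y`, evaluated at `x`. Derivatives are those
of `g` as a function on the cube `[0,1]^m` (one-sided at its faces). -/
def taylorPoly {m : ℕ} (g : (Fin m → ℝ) → ℝ) (k : ℕ) (y x : Fin m → ℝ) : ℝ :=
  ∑ j ∈ Finset.range (k + 1),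
    ((j.factorial : ℝ))⁻¹ * iteratedFDerivWithin ℝ j g (Icc 0 1) y (fun _ => x - y)

/-- The Hölder class `Σ(lam, α)` of functions `g : [0,1]^m → [0,1]`. Only the values of `g` on
the cube matter. The norm of `Fin m → ℝ` is the maximum norm. -/
structure IsHolder {m : ℕ} (lam α : ℝ) (g : (Fin m → ℝ) → ℝ) : Prop where
  mapsTo : MapsTo g (Icc 0 1) (Icc 0 1)
  contDiffOn : ContDiffOn ℝ (strictFloor α : ℕ) g (Icc 0 1)
  taylor_le : ∀ x ∈ Icc (0 : Fin m → ℝ) 1, ∀ y ∈ Icc (0 : Fin m → ℝ) 1,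
    ∀ β : ℝ, 0 < β → β ≤ α →
      |g x - taylorPoly g (strictFloor β) y x| ≤ lam * ‖x - y‖ ^ β

/-- The epigraph of `g` in `[0,1]^d`. -/
def epi {d : ℕ} (g : (Fin (d - 1) → ℝ) → ℝ) : Set (Feature d) :=
  {x | g x.tilde ≤ x.last}

/-! ### Classification problems -/

/-- A classification problem on `[0,1]^d`, given by the marginal law of `X` and the
regression function `η(x) = P(Y = 1 | X = x)`, defined at every point. -/
structure Problem (d : ℕ) where
  PX : Measure (Feature d)
  isProb : IsProbabilityMeasure PX
  η : Feature d → ℝ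
  measurable_η : Measurable η
  η_mem : ∀ x, η x ∈ Icc (0 : ℝ) 1

/-- The conditional law of the label given `X = x`: Bernoulli with parameter `η x`
(`true` is the label `1`, `false` is the label `0`). -/
def Problem.labelKernel {d : ℕ} (P : Problem d) : Kernel (Feature d) Bool where
  toFun x := ENNReal.ofReal (P.η x) • Measure.dirac true
    + ENNReal.ofReal (1 - P.η x) • Measure.dirac false
  measurable' := by
    refine Measure.measurable_of_measurable_coe _ fun s _ => ?_
    simp only [Measure.coe_add, Measure.coe_smul, Pi.add_apply, Pi.smul_apply, smul_eq_mul]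
    exact (P.measurable_η.ennreal_ofReal.mul_const _).add
      ((measurable_const.sub P.measurable_η).ennreal_ofReal.mul_const _)

/-- The conditional label laws are probability measures (also used to compose kernels). -/
instance Problem.isMarkov_labelKernel {d : ℕ} (P : Problem d) :
    IsMarkovKernel P.labelKernel := by
  refine ⟨fun x => ⟨?_⟩⟩
  have h := P.η_mem x
  change (ENNReal.ofReal (P.η x) • Measure.dirac true
    + ENNReal.ofReal (1 - P.η x) • Measure.dirac false : Measure Bool) univ = 1
  simp only [Measure.coe_add, Measure.coe_smul, Pi.add_apply, Pi.smul_apply, smul_eq_mul,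
    measure_univ, mul_one]
  rw [← ENNReal.ofReal_add h.1 (by linarith [h.2])]
  simp

/-- The joint law of `(X, Y)`. -/
def Problem.joint {d : ℕ} (P : Problem d) : Measure (Feature d × Bool) :=
  P.PX ⊗ₘ P.labelKernel

/-- The 0-1 risk `R(f) = P(Y ≠ f(X))`. -/
def Problem.risk {d : ℕ} (P : Problem d) (f : Feature d → Bool) : ℝ :=
  P.joint.real {z | z.2 ≠ f z.1}

open Classical in
/-- The Bayes classifier `1{η ≥ 1/2}`. -/
def Problem.bayes {d : ℕ} (P : Problem d) (x : Feature d) : Bool :=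
  decide (1 / 2 ≤ P.η x)

/-- The excess risk `R(f) - R(f*)`. -/
def Problem.excessRisk {d : ℕ} (P : Problem d) (f : Feature d → Bool) : ℝ :=
  P.risk f - P.risk P.bayes

/-- The class `P(α, κ, κ')` for fixed constants `lam, c` and `C₃, Δ₀`: the boundary `g` is a
`(lam, α)`-Hölder function, `η` satisfies the geometric noise condition with `c, κ`, and the
excess risk carried by the strip of half-width `Δ` around the boundary is at most `C₃ Δ^κ'`
for all `Δ ∈ [0, Δ₀]`. -/
def problemClass (d : ℕ) (lam α c κ C₃ Δ₀ κ' : ℝ) : Set (Problem d) :=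
  {P | ∃ g : (Fin (d - 1) → ℝ) → ℝ,
    IsHolder lam α g ∧
    {x | 1 / 2 ≤ P.η x} = epi g ∧
    (∀ x : Feature d, c * |x.last - g x.tilde| ^ (κ - 1) ≤ |P.η x - 1 / 2|) ∧
    (∀ Δ ∈ Icc 0 Δ₀,
      ∫ x in {x : Feature d | |x.last - g x.tilde| ≤ Δ}, |1 - 2 * P.η x| ∂P.PX ≤ C₃ * Δ ^ κ')}

/-! ### Active strategies -/

/-- The first `t` queried points with their labels. -/
abbrev History (d t : ℕ) : Type := Fin t → Feature d × Bool

/-- A randomized active strategy on `[0,1]^d`. The seed carries all the internal randomness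
(for instance an unlabelled sample). The point queried after `t` labels depends on the seed and
on the history so far, and after `n` labels a classifier is returned. A strategy that stops
before its budget `n` is spent is covered: it repeats some query and ignores the answers. -/
structure ActiveStrategy (d n : ℕ) where
  Seed : Type u
  mSeed : MeasurableSpace Seed
  seedLaw : Measure Seed
  isProb : IsProbabilityMeasure seedLaw
  query : (t : ℕ) → Seed × History d t → Feature d
  measurable_query : ∀ t, Measurable (query t)
  classify : Seed × History d n → Feature d → Bool
  measurable_classify : Measurable (Function.uncurry classify)

attribute [instance] ActiveStrategy.mSeed

/-- The joint law of the seed and the first `t` queries and labels, when strategy `A` is run on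
problem `P`: each new label is drawn from the conditional law of `Y` at the queried point. -/
def ActiveStrategy.law {d n : ℕ} (A : ActiveStrategy.{u} d n) (P : Problem d) :
    (t : ℕ) → Measure (A.Seed × History d t)
  | 0 => A.seedLaw.map (fun ω => (ω, Fin.elim0))
  | t + 1 =>
    (A.law P t ⊗ₘ P.labelKernel.comap (A.query t) (A.measurable_query t)).map
      (fun p => (p.1.1, Fin.snoc p.1.2 (A.query t p.1, p.2)))

/-- The expected excess risk of the classifier returned by `A` after `n` labels. -/
def ActiveStrategy.expectedExcessRisk {d n : ℕ} (A : ActiveStrategy.{u} d n)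
    (P : Problem d) : ℝ≥0∞ :=
  ∫⁻ h, ENNReal.ofReal (P.excessRisk (A.classify h)) ∂(A.law P n)

/-- The minimax expected excess risk over a class of problems with `n` labels. The learner may
also know the marginal law of `X`: a strategy is chosen for each marginal law. In particular,
strategies that sample from the marginal law are included. -/
def minimaxRisk {d : ℕ} (n : ℕ) (Q : Set (Problem d)) : ℝ≥0∞ :=
  ⨅ A : Measure (Feature d) → ActiveStrategy.{u} d n,
    ⨆ P ∈ Q, (A P.PX).expectedExcessRisk P

end

end ActiveLearning

/-!
Assouad's lemma over a cube of signs. Divide `[0,1]^(d-1)` into `K^(d-1)` cells, put a bump of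
height `± h` with `h ≍ K^(-α)` on a fixed level `b` above each cell, and let the marginal law
charge the points at level `b` above the centres of the cells. Flipping the sign of one cell
changes the label law only above that cell, and only to an extent `h^(κ-1)`, so a query there costs
`O(h^(2(κ-1)))` of the Hellinger affinity of the two histories. The `n` queries are shared among
`K^(d-1)` disjoint cells; hence when `n h^(2(κ-1)) ≲ K^(d-1)` any strategy misclassifies a constant
fraction of the grid points. The mass of the grid points is chosen so that this costs `≍ h^κ'`, the
most that the third condition of the class allows. The balance `n ≍ K^(2α(κ-1)+d-1)` gives the rate.
-/

namespace ActiveLearning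

noncomputable section

/-! ### Taylor remainders -/

section Taylor

variable {E F : Type*} [NormedAddCommGroup E] [NormedSpace ℝ E]
  [NormedAddCommGroup F] [NormedSpace ℝ F] {g : E → F}

theorem iteratedDeriv_comp_add_smul {j : ℕ} (hg : ContDiff ℝ j g) (y v : E) (t : ℝ) :
    iteratedDeriv j (fun s : ℝ => g (y + s • v)) t
      = iteratedFDeriv ℝ j g (y + t • v) (fun _ => v) := by
  have h_comp : (fun s : ℝ => g (y + s • v))
      = (fun z => g (y + z)) ∘ ContinuousLinearMap.toSpanSingleton ℝ v := by
    ext s; simp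
  have h_shift : ContDiff ℝ j (fun z => g (y + z)) :=
    hg.comp (contDiff_const.add contDiff_id)
  rw [iteratedDeriv, h_comp, ContinuousLinearMap.iteratedFDeriv_comp_right _ h_shift _ le_rfl,
    iteratedFDeriv_comp_add_left]
  simp [ContinuousMultilinearMap.compContinuousLinearMap_apply]

/-- The Taylor polynomial of degree `k` of `g` at `y`, evaluated at `x`. In contrast to
`taylorPoly`, it uses the derivatives on the whole space instead of those within the cube. -/
def taylorSum (g : E → F) (k : ℕ) (y x : E) : F :=
  ∑ j ∈ Finset.range (k + 1),
    (j.factorial : ℝ)⁻¹ • iteratedFDeriv ℝ j g y (fun _ => x - y)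

theorem norm_sub_taylorSum_le {k : ℕ} {M : ℝ} (hg : ContDiff ℝ (k + 1 : ℕ) g)
    (hM : ∀ z, ‖iteratedFDeriv ℝ (k + 1) g z‖ ≤ M) (x y : E) :
    ‖g x - taylorSum g k y x‖ ≤ M * ‖x - y‖ ^ (k + 1) := by
  set p : ℝ → F := fun t => g (y + t • (x - y)) with hp
  have hp_smooth : ContDiff ℝ (k + 1 : ℕ) p :=
    hg.comp (contDiff_const.add (contDiff_id.smul contDiff_const))
  have hp_deriv : ∀ j ≤ k + 1, ∀ t ∈ Icc (0 : ℝ) 1, iteratedDerivWithin j p (Icc 0 1) t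
      = iteratedFDeriv ℝ j g (y + t • (x - y)) (fun _ => x - y) := by
    intro j hj t ht
    have hj' : (j : WithTop ℕ∞) ≤ (k + 1 : ℕ) := by exact_mod_cast hj
    rw [iteratedDerivWithin_eq_iteratedDeriv (uniqueDiffOn_Icc one_pos)
      (hp_smooth.of_le hj').contDiffAt ht, iteratedDeriv_comp_add_smul (hg.of_le hj')]
  have h_deriv_le : ∀ t ∈ Icc (0 : ℝ) 1,
      ‖iteratedDerivWithin (k + 1) p (Icc 0 1) t‖ ≤ M * ‖x - y‖ ^ (k + 1) := by
    intro t ht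
    rw [hp_deriv _ le_rfl t ht]
    simpa using (iteratedFDeriv ℝ (k + 1) g (y + t • (x - y))).le_of_opNorm_le
      (hM _) (fun _ => x - y)
  have h_taylor : taylorWithinEval p k (Icc 0 1) 0 1 = taylorSum g k y x := by
    rw [taylor_within_apply]
    refine Finset.sum_congr rfl fun j hj => ?_
    rw [hp_deriv j (Finset.mem_range.1 hj).le 0 (left_mem_Icc.2 zero_le_one)]
    simp
  have h_rem := taylor_mean_remainder_bound zero_le_one
    (by exact_mod_cast hp_smooth.contDiffOn) (right_mem_Icc.2 zero_le_one) h_deriv_le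
  rw [h_taylor] at h_rem
  simp only [hp, one_smul, add_sub_cancel, sub_zero, one_pow, mul_one] at h_rem
  have hM0 : 0 ≤ M := (norm_nonneg _).trans (hM y)
  exact h_rem.trans (div_le_self (by positivity) (by exact_mod_cast k.factorial_pos))

variable {k : ℕ} {H K β : ℝ}

theorem norm_iteratedFDeriv_apply_const_le {j : ℕ} {y : E}
    (hD : ‖iteratedFDeriv ℝ j g y‖ ≤ H * K ^ j) (v : E) :
    ‖iteratedFDeriv ℝ j g y (fun _ => v)‖ ≤ H * (K * ‖v‖) ^ j := by
  simpa [mul_pow, mul_assoc] using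
    (iteratedFDeriv ℝ j g y).le_of_opNorm_le hD (fun _ => v)

theorem norm_sub_taylorSum_le_of_one_le (hosc : ∀ x y, ‖g x - g y‖ ≤ 2 * H)
    (hD : ∀ j ∈ Icc 1 k, ∀ z, ‖iteratedFDeriv ℝ j g z‖ ≤ H * K ^ j)
    (hkβ : (k : ℝ) ≤ β) {x y : E} (hxy : 1 ≤ K * ‖x - y‖) :
    ‖g x - taylorSum g k y x‖ ≤ H * (k + 2) * (K * ‖x - y‖) ^ β := by
  set r := K * ‖x - y‖
  have hH : 0 ≤ H := by simpa using hosc x x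
  have h_pow : ∀ j ≤ k, r ^ j ≤ r ^ β := fun j hj =>
    (Real.rpow_natCast r j).symm.trans_le
      (Real.rpow_le_rpow_of_exponent_le hxy ((Nat.cast_le.2 hj).trans hkβ))
  have h_term : ∀ j ∈ Finset.range k, ‖((j + 1).factorial : ℝ)⁻¹ •
      iteratedFDeriv ℝ (j + 1) g y (fun _ => x - y)‖ ≤ H * r ^ β := by
    intro j hj
    have hjk : j + 1 ≤ k := Finset.mem_range.1 hj
    have h_inv : ((j + 1).factorial : ℝ)⁻¹ ≤ 1 :=
      inv_le_one_of_one_le₀ (by exact_mod_cast (j + 1).factorial_pos)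
    rw [norm_smul, Real.norm_of_nonneg (by positivity)]
    refine (mul_le_of_le_one_left (norm_nonneg _) h_inv).trans ?_
    exact (norm_iteratedFDeriv_apply_const_le (hD _ ⟨by omega, hjk⟩ y) _).trans
      (by gcongr; exact h_pow _ hjk)
  have h_split : g x - taylorSum g k y x = (g x - g y) - ∑ j ∈ Finset.range k,
      ((j + 1).factorial : ℝ)⁻¹ • iteratedFDeriv ℝ (j + 1) g y (fun _ => x - y) := by
    rw [taylorSum, Finset.sum_range_succ']
    simp [sub_sub, add_comm]
  calc ‖g x - taylorSum g k y x‖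
      ≤ 2 * H * 1 + k * (H * r ^ β) := by
        rw [h_split, mul_one]
        refine (norm_sub_le _ _).trans (add_le_add (hosc x y) ?_)
        simpa using norm_sum_le_of_le _ h_term
    _ ≤ 2 * H * r ^ β + k * (H * r ^ β) := by
        gcongr
        simpa using h_pow 0 k.zero_le
    _ = H * (k + 2) * r ^ β := by ring

theorem norm_sub_taylorSum_le_rpow (hg : ContDiff ℝ (k + 1 : ℕ) g) (hK : 0 ≤ K)
    (hosc : ∀ x y, ‖g x - g y‖ ≤ 2 * H)
    (hD : ∀ j ∈ Icc 1 (k + 1), ∀ z, ‖iteratedFDeriv ℝ j g z‖ ≤ H * K ^ j)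
    (hkβ : (k : ℝ) ≤ β) (hβk : β ≤ k + 1) (x y : E) :
    ‖g x - taylorSum g k y x‖ ≤ H * (k + 2) * (K * ‖x - y‖) ^ β := by
  have hH : 0 ≤ H := by simpa using hosc x x
  have hβ : 0 ≤ β := k.cast_nonneg.trans hkβ
  rcases le_total (K * ‖x - y‖) 1 with hxy | hxy
  · calc ‖g x - taylorSum g k y x‖
        ≤ H * 1 * (K * ‖x - y‖) ^ ((k + 1 : ℕ) : ℝ) := by
          rw [Real.rpow_natCast, mul_one, mul_pow, ← mul_assoc]
          exact norm_sub_taylorSum_le hg (hD (k + 1) ⟨by omega, le_rfl⟩) x y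
      _ ≤ H * (k + 2) * (K * ‖x - y‖) ^ β := by
          gcongr ?_ * ?_ * ?_
          · linarith [k.cast_nonneg (α := ℝ)]
          · exact Real.rpow_le_rpow_of_exponent_ge' (by positivity) hxy hβ (by exact_mod_cast hβk)
  · exact norm_sub_taylorSum_le_of_one_le hosc
      (fun j hj => hD j ⟨hj.1, hj.2.trans k.le_succ⟩) hkβ hxy

end Taylor

/-! ### Hölder classes -/

theorem strictFloor_lt {β : ℝ} (hβ : 0 < β) : (strictFloor β : ℝ) < β := by
  have := Nat.one_le_ceil_iff.2 hβ
  exact Nat.lt_ceil.1 (by unfold strictFloor; omega)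

theorem le_strictFloor_add_one (β : ℝ) : β ≤ strictFloor β + 1 :=
  (Nat.le_ceil β).trans (by exact_mod_cast Nat.le_add_of_sub_le le_rfl)

theorem strictFloor_mono : Monotone strictFloor :=
  fun _ _ h => Nat.sub_le_sub_right (Nat.ceil_mono h) 1

theorem uniqueDiffOn_Icc_pi {ι : Type*} [Finite ι] {a b : ι → ℝ} (hab : ∀ i, a i < b i) :
    UniqueDiffOn ℝ (Icc a b) := by
  cases nonempty_fintype ι
  rw [← pi_univ_Icc]
  exact UniqueDiffOn.univ_pi fun i => uniqueDiffOn_Icc (hab i)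

theorem taylorPoly_eq_taylorSum {m k : ℕ} {g : (Fin m → ℝ) → ℝ} (hg : ContDiff ℝ k g)
    {y : Fin m → ℝ} (hy : y ∈ Icc 0 1) (x : Fin m → ℝ) :
    taylorPoly g k y x = taylorSum g k y x := by
  refine Finset.sum_congr rfl fun j hj => ?_
  have hjk : (j : WithTop ℕ∞) ≤ k := by exact_mod_cast Finset.mem_range_succ_iff.1 hj
  rw [iteratedFDerivWithin_eq_iteratedFDeriv (uniqueDiffOn_Icc_pi fun _ => zero_lt_one)
    (hg.of_le hjk).contDiffAt hy, smul_eq_mul]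

theorem isHolder_of_norm_iteratedFDeriv_le {m : ℕ} {lam α H K : ℝ} {g : (Fin m → ℝ) → ℝ}
    (hg : ContDiff ℝ (strictFloor α + 1 : ℕ) g) (hmaps : MapsTo g (Icc 0 1) (Icc 0 1))
    (hosc : ∀ x y, ‖g x - g y‖ ≤ 2 * H)
    (hD : ∀ j ∈ Icc 1 (strictFloor α + 1), ∀ z, ‖iteratedFDeriv ℝ j g z‖ ≤ H * K ^ j)
    (hK : 1 ≤ K) (hlam : H * (strictFloor α + 2) * K ^ α ≤ lam) : IsHolder lam α g where
  mapsTo := hmaps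
  contDiffOn := (hg.of_le (by exact_mod_cast Nat.le_succ _)).contDiffOn
  taylor_le x _ y hy β hβ hβα := by
    have hH : 0 ≤ H := by simpa using hosc 0 0
    have hk : strictFloor β ≤ strictFloor α := strictFloor_mono hβα
    have hgβ : ContDiff ℝ (strictFloor β + 1 : ℕ) g :=
      hg.of_le (by exact_mod_cast Nat.succ_le_succ hk)
    rw [taylorPoly_eq_taylorSum (hgβ.of_le (by exact_mod_cast Nat.le_succ _)) hy,
      ← Real.norm_eq_abs]
    calc ‖g x - taylorSum g (strictFloor β) y x‖
        ≤ H * (strictFloor β + 2) * (K * ‖x - y‖) ^ β :=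
          norm_sub_taylorSum_le_rpow hgβ (zero_le_one.trans hK) hosc
            (fun j hj => hD j ⟨hj.1, hj.2.trans (Nat.succ_le_succ hk)⟩)
            (strictFloor_lt hβ).le (le_strictFloor_add_one β) x y
      _ = H * (strictFloor β + 2) * K ^ β * ‖x - y‖ ^ β := by
          rw [Real.mul_rpow (by positivity) (norm_nonneg _), mul_assoc (H * _)]
      _ ≤ H * (strictFloor α + 2) * K ^ α * ‖x - y‖ ^ β := by
          gcongr
      _ ≤ lam * ‖x - y‖ ^ β := by gcongr

/-! ### Sums of disjoint bumps -/

section BumpSum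

variable {ι E F : Type*} [Fintype ι] [NormedAddCommGroup E]
  [NormedAddCommGroup F] [NormedSpace ℝ F] {c : ι → E} {s : ι → ℝ}

theorem norm_sum_smul_translate_le {ψ : E → F} {r B : ℝ} (hψ : ∀ u, ‖ψ u‖ ≤ B)
    (hsupp : Function.support ψ ⊆ Metric.closedBall 0 r)
    (hc : Pairwise (Function.onFun Disjoint fun i => Metric.closedBall (c i) r))
    (hs : ∀ i, |s i| ≤ 1) (u : E) : ‖∑ i, s i • ψ (u - c i)‖ ≤ B := by
  have hB : 0 ≤ B := (norm_nonneg _).trans (hψ 0)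
  have h_mem : ∀ i, s i • ψ (u - c i) ≠ 0 → u ∈ Metric.closedBall (c i) r := fun i hi => by
    simpa [dist_eq_norm] using hsupp (right_ne_zero_of_smul hi)
  by_cases h_zero : ∀ i, s i • ψ (u - c i) = 0
  · simpa [h_zero] using hB
  · obtain ⟨i, hi⟩ := not_forall.1 h_zero
    rw [Finset.sum_eq_single i (fun j _ hji => ?_) (by simp), norm_smul]
    · exact (mul_le_of_le_one_left (norm_nonneg _) (hs i)).trans (hψ _)
    · by_contra hj
      exact hji (hc.eq (not_disjoint_iff.2 ⟨u, h_mem j hj, h_mem i hi⟩))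

variable [NormedSpace ℝ E]

theorem exists_norm_iteratedFDeriv_le_of_hasCompactSupport {f : E → F} {k : ℕ}
    (hf : ContDiff ℝ k f) (hsupp : HasCompactSupport f) :
    ∃ B, ∀ j ≤ k, ∀ u, ‖iteratedFDeriv ℝ j f u‖ ≤ B := by
  have h_each : ∀ j : ℕ, ∃ B, j ≤ k → ∀ u, ‖iteratedFDeriv ℝ j f u‖ ≤ B := fun j => by
    by_cases hj : j ≤ k
    · obtain ⟨B, hB⟩ := (hsupp.iteratedFDeriv (𝕜 := ℝ) j).exists_bound_of_continuous
        (hf.continuous_iteratedFDeriv (by exact_mod_cast hj))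
      exact ⟨B, fun _ => hB⟩
    · exact ⟨0, fun h => absurd h hj⟩
  choose B hB using h_each
  obtain ⟨M, hM⟩ := ((Finset.range (k + 1)).image B).exists_le
  exact ⟨M, fun j hj u => (hB j hj u).trans
    (hM _ (Finset.mem_image_of_mem B (Finset.mem_range_succ_iff.2 hj)))⟩

variable [HasContDiffBump E] {φ : ContDiffBump (0 : E)}

/-- The combination of the translates of the bump `φ` to the centres `c i`, with
coefficients `s i`. -/
def bumpSum (φ : ContDiffBump (0 : E)) (c : ι → E) (s : ι → ℝ) (u : E) : ℝ :=
  ∑ i, s i • φ (u - c i)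

theorem contDiff_bumpSum {n : ℕ∞} : ContDiff ℝ n (bumpSum φ c s) :=
  ContDiff.sum fun i _ => (φ.contDiff.comp (contDiff_id.sub contDiff_const)).const_smul (s i)

theorem norm_iteratedFDeriv_bumpSum_le {j : ℕ} {B : ℝ}
    (hB : ∀ u, ‖iteratedFDeriv ℝ j φ u‖ ≤ B)
    (hc : Pairwise (Function.onFun Disjoint fun i => Metric.closedBall (c i) φ.rOut))
    (hs : ∀ i, |s i| ≤ 1) (u : E) : ‖iteratedFDeriv ℝ j (bumpSum φ c s) u‖ ≤ B := by
  have h_smooth : ∀ i, ContDiff ℝ j (fun u => φ (u - c i)) := fun i =>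
    φ.contDiff.comp (contDiff_id.sub contDiff_const)
  have h_deriv : iteratedFDeriv ℝ j (bumpSum φ c s) u
      = ∑ i, s i • iteratedFDeriv ℝ j φ (u - c i) := by
    unfold bumpSum
    rw [iteratedFDeriv_fun_sum_apply fun i _ => ((h_smooth i).const_smul (s i)).contDiffAt]
    refine Finset.sum_congr rfl fun i _ => ?_
    rw [iteratedFDeriv_const_smul_apply' (h_smooth i).contDiffAt, iteratedFDeriv_comp_sub]
  rw [h_deriv]
  exact norm_sum_smul_translate_le hB
    ((support_iteratedFDeriv_subset j).trans_eq φ.tsupport_eq) hc hs u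

theorem abs_bumpSum_le_one
    (hc : Pairwise (Function.onFun Disjoint fun i => Metric.closedBall (c i) φ.rOut))
    (hs : ∀ i, |s i| ≤ 1) (u : E) : |bumpSum φ c s u| ≤ 1 :=
  norm_sum_smul_translate_le (fun u => by simpa [abs_of_nonneg φ.nonneg] using φ.le_one)
    (φ.support_eq.trans_subset Metric.ball_subset_closedBall) hc hs u

theorem bumpSum_center
    (hc : Pairwise (Function.onFun Disjoint fun i => Metric.closedBall (c i) φ.rOut)) (i : ι) :
    bumpSum φ c s (c i) = s i := by
  have h_self : φ (c i - c i) = 1 :=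
    φ.one_of_mem_closedBall (by simpa using φ.rIn_pos.le)
  rw [bumpSum, Finset.sum_eq_single i (fun j _ hji => ?_) (by simp), h_self, smul_eq_mul, mul_one]
  rw [φ.zero_of_le_dist, smul_zero]
  by_contra! h_lt
  rw [dist_zero_right, ← dist_eq_norm] at h_lt
  exact hji (hc.eq (not_disjoint_iff.2
    ⟨c i, h_lt.le, Metric.mem_closedBall_self φ.rOut_pos.le⟩))

theorem bumpSum_update [DecidableEq ι] (i : ι) (a : ℝ) {u : E}
    (hu : u ∉ Metric.ball (c i) φ.rOut) :
    bumpSum φ c (Function.update s i a) u = bumpSum φ c s u := by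
  refine Finset.sum_congr rfl fun j _ => ?_
  rcases eq_or_ne j i with rfl | hji
  · rw [φ.zero_of_le_dist (by simpa [dist_eq_norm] using hu), smul_zero, smul_zero]
  · rw [Function.update_of_ne hji]

end BumpSum

/-! ### Perturbed boundaries -/

theorem norm_iteratedFDeriv_const_add_smul_comp_smul {E F : Type*} [NormedAddCommGroup E]
    [NormedSpace ℝ E] [NormedAddCommGroup F] [NormedSpace ℝ F] {G : E → F} {j : ℕ}
    (hG : ContDiff ℝ j G) (hj : j ≠ 0) (b : F) (h a : ℝ) (x : E) :
    ‖iteratedFDeriv ℝ j (fun x => b + h • G (a • x)) x‖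
      = |h| * |a| ^ j * ‖iteratedFDeriv ℝ j G (a • x)‖ := by
  have h_scaled : ContDiff ℝ j (fun x => G (a • x)) := hG.comp (contDiff_id.const_smul a)
  change ‖iteratedFDeriv ℝ j ((fun _ => b) + fun x => h • G (a • x)) x‖ = _
  rw [iteratedFDeriv_add_apply contDiff_const.contDiffAt (h_scaled.const_smul h).contDiffAt,
    iteratedFDeriv_const_of_ne hj, iteratedFDeriv_const_smul_apply' h_scaled.contDiffAt,
    iteratedFDeriv_comp_const_smul _ hG]
  simp [norm_smul, mul_assoc]

/-- The bump placed in each cell of the grid, supported in the cube of half-width `1/4`. -/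
def cellBump (m : ℕ) : ContDiffBump (0 : Fin m → ℝ) :=
  ⟨1 / 8, 1 / 4, by norm_num, by norm_num⟩

/-- The centre of the cell with index `j` when `[0,K]^m` is cut into unit cells. -/
def cellCenter {m K : ℕ} (j : Fin m → Fin K) : Fin m → ℝ := fun i => (j i : ℝ) + 1 / 2

/-- The sign of the bump in a cell with label `y`. The label `1` is the Bayes label above the
boundary, so it is produced by lowering the boundary. -/
def cellSign (y : Bool) : ℝ := if y then -1 else 1

theorem abs_cellSign (y : Bool) : |cellSign y| = 1 := by cases y <;> simp [cellSign]

theorem pairwise_disjoint_closedBall_cellCenter (m K : ℕ) : Pairwise (Function.onFun Disjoint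
    fun j : Fin m → Fin K => Metric.closedBall (cellCenter j) (cellBump m).rOut) := by
  refine fun i j hij => disjoint_left.2 fun u hui huj => hij ?_
  ext l
  have hi := abs_le.1 ((norm_le_pi_norm (u - cellCenter i) l).trans (mem_closedBall_iff_norm.1 hui))
  have hj := abs_le.1 ((norm_le_pi_norm (u - cellCenter j) l).trans (mem_closedBall_iff_norm.1 huj))
  simp only [Pi.sub_apply, cellCenter, cellBump] at hi hj
  have h_lt : ((i l : ℕ) : ℝ) < (j l : ℕ) + 1 := by linarith
  have h_gt : ((j l : ℕ) : ℝ) < (i l : ℕ) + 1 := by linarith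
  norm_cast at h_lt h_gt
  omega

section BumpBoundary

variable {m K : ℕ} {b h : ℝ} {σ : (Fin m → Fin K) → Bool}

/-- The level `b`, perturbed in the cell `j` of `[0,1]^m` by a bump of height `h` whose sign is
given by the label `σ j`. -/
def bumpBoundary (b h : ℝ) (σ : (Fin m → Fin K) → Bool) (x : Fin m → ℝ) : ℝ :=
  b + h • bumpSum (cellBump m) cellCenter (cellSign ∘ σ) ((K : ℝ) • x)

theorem contDiff_bumpBoundary {n : ℕ∞} : ContDiff ℝ n (bumpBoundary b h σ) :=
  contDiff_const.add ((contDiff_bumpSum.comp (contDiff_id.const_smul (K : ℝ))).const_smul h)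

theorem abs_bumpBoundary_sub_le (hh : 0 ≤ h) (x : Fin m → ℝ) :
    |bumpBoundary b h σ x - b| ≤ h := by
  rw [bumpBoundary, add_sub_cancel_left, smul_eq_mul, abs_mul, abs_of_nonneg hh]
  exact mul_le_of_le_one_right hh (abs_bumpSum_le_one
    (pairwise_disjoint_closedBall_cellCenter m K) (fun j => (abs_cellSign (σ j)).le) _)

theorem exists_isHolder_bumpBoundary (m : ℕ) (α : ℝ) :
    ∃ A : ℝ, ∀ (lam : ℝ) (K : ℕ) (b h : ℝ) (σ : (Fin m → Fin K) → Bool), 0 < K → 0 ≤ h →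
      h ≤ b → b + h ≤ 1 → A * h * (K : ℝ) ^ α ≤ lam → IsHolder lam α (bumpBoundary b h σ) := by
  obtain ⟨B, hB⟩ := exists_norm_iteratedFDeriv_le_of_hasCompactSupport
    ((cellBump m).contDiff (n := (strictFloor α + 1 : ℕ))) (cellBump m).hasCompactSupport
  refine ⟨B * (strictFloor α + 2), fun lam K b h σ hK hh hhb hbh hA => ?_⟩
  have h_bumps : ∀ j ≤ strictFloor α + 1, ∀ u, ‖iteratedFDeriv ℝ j
      (bumpSum (cellBump m) cellCenter (cellSign ∘ σ)) u‖ ≤ B := fun j hj =>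
    norm_iteratedFDeriv_bumpSum_le (hB j hj) (pairwise_disjoint_closedBall_cellCenter m K)
      (fun i => (abs_cellSign (σ i)).le)
  have h_near : ∀ x, |bumpBoundary b h σ x - b| ≤ h * B := fun x => by
    rw [bumpBoundary, add_sub_cancel_left, smul_eq_mul, abs_mul, abs_of_nonneg hh]
    gcongr
    simpa using h_bumps 0 (Nat.zero_le _) ((K : ℝ) • x)
  refine isHolder_of_norm_iteratedFDeriv_le (H := h * B) (K := K) contDiff_bumpBoundary
    (fun x _ => ?_) (fun x y => ?_) (fun j hj x => ?_) (by exact_mod_cast hK)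
    (hA.trans_eq' (by ring))
  · have := abs_le.1 (abs_bumpBoundary_sub_le (b := b) (σ := σ) hh x)
    exact ⟨by linarith, by linarith⟩
  · calc ‖bumpBoundary b h σ x - bumpBoundary b h σ y‖
        ≤ |bumpBoundary b h σ x - b| + |bumpBoundary b h σ y - b| := by
          simpa [abs_sub_comm b] using abs_sub_le (bumpBoundary b h σ x) b (bumpBoundary b h σ y)
      _ ≤ 2 * (h * B) := by linarith [h_near x, h_near y]
  · have hj0 : j ≠ 0 := Nat.one_le_iff_ne_zero.1 hj.1
    unfold bumpBoundary
    rw [norm_iteratedFDeriv_const_add_smul_comp_smul contDiff_bumpSum hj0, abs_of_nonneg hh,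
      Nat.abs_cast, mul_right_comm h B]
    gcongr
    exact h_bumps j hj.2 _

theorem bumpBoundary_update (j : Fin m → Fin K) (y : Bool) {x : Fin m → ℝ}
    (hx : (K : ℝ) • x ∉ Metric.ball (cellCenter j) (cellBump m).rOut) :
    bumpBoundary b h (Function.update σ j y) x = bumpBoundary b h σ x := by
  rw [bumpBoundary, Function.comp_update, bumpSum_update j _ hx, bumpBoundary]

theorem bumpBoundary_of_smul_eq_cellCenter {x : Fin m → ℝ} {j : Fin m → Fin K}
    (hx : (K : ℝ) • x = cellCenter j) : bumpBoundary b h σ x = b + h * cellSign (σ j) := by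
  rw [bumpBoundary, hx, bumpSum_center (pairwise_disjoint_closedBall_cellCenter m K),
    Function.comp_apply, smul_eq_mul]

end BumpBoundary

/-! ### Laws of histories and likelihoods -/

section Histories

variable {d n : ℕ}

/-- The probability of the label `y` at the point `x`. -/
def Problem.labelProb (P : Problem d) (x : Feature d) (y : Bool) : ℝ :=
  if y then P.η x else 1 - P.η x

theorem Problem.labelProb_nonneg (P : Problem d) (x : Feature d) (y : Bool) :
    0 ≤ P.labelProb x y := by
  have hη := P.η_mem x
  cases y
  · exact sub_nonneg.2 hη.2
  · exact hη.1

theorem Problem.measurable_labelProb (P : Problem d) :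
    Measurable fun z : Feature d × Bool => P.labelProb z.1 z.2 :=
  Measurable.ite (measurable_snd (measurableSet_singleton true))
    (P.measurable_η.comp measurable_fst) (measurable_const.sub (P.measurable_η.comp measurable_fst))

theorem Problem.lintegral_labelKernel (P : Problem d) (x : Feature d) (Φ : Bool → ℝ≥0∞) :
    ∫⁻ y, Φ y ∂(P.labelKernel x) = ∑ y, ENNReal.ofReal (P.labelProb x y) * Φ y := by
  change ∫⁻ y, Φ y ∂(ENNReal.ofReal (P.η x) • Measure.dirac true
    + ENNReal.ofReal (1 - P.η x) • Measure.dirac false : Measure Bool) = _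
  simp [lintegral_add_measure, Problem.labelProb]

namespace ActiveStrategy

/-- The seed and the history after the query at time `t` has been answered by a label. -/
def extend (A : ActiveStrategy.{u} d n) (t : ℕ) (p : (A.Seed × History d t) × Bool) :
    A.Seed × History d (t + 1) :=
  (p.1.1, Fin.snoc p.1.2 (A.query t p.1, p.2))

theorem measurable_extend (A : ActiveStrategy.{u} d n) (t : ℕ) : Measurable (A.extend t) := by
  refine measurable_fst.fst.prodMk (measurable_pi_lambda _ (Fin.lastCases ?_ fun i => ?_))
  · simp only [Fin.snoc_last]
    exact ((A.measurable_query t).comp measurable_fst).prodMk measurable_snd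
  · simp only [Fin.snoc_castSucc]
    exact (measurable_pi_apply i).comp measurable_fst.snd

instance isProbabilityMeasure_law (A : ActiveStrategy.{u} d n) (P : Problem d) (t : ℕ) :
    IsProbabilityMeasure (A.law P t) := by
  induction t with
  | zero =>
    have := A.isProb
    exact Measure.isProbabilityMeasure_map (measurable_id.prodMk measurable_const).aemeasurable
  | succ t ih => exact Measure.isProbabilityMeasure_map (A.measurable_extend t).aemeasurable

theorem lintegral_law_succ (A : ActiveStrategy.{u} d n) (P : Problem d) (t : ℕ)
    {Φ : A.Seed × History d (t + 1) → ℝ≥0∞} (hΦ : Measurable Φ) :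
    ∫⁻ p, Φ p ∂(A.law P (t + 1)) = ∫⁻ p, ∑ y,
      ENNReal.ofReal (P.labelProb (A.query t p) y) * Φ (A.extend t (p, y)) ∂(A.law P t) := by
  change ∫⁻ p, Φ p ∂((A.law P t ⊗ₘ P.labelKernel.comap (A.query t) (A.measurable_query t)).map
    (A.extend t)) = _
  rw [lintegral_map hΦ (A.measurable_extend t),
    Measure.lintegral_compProd (hΦ.fun_comp (A.measurable_extend t))]
  refine lintegral_congr fun p => ?_
  rw [Kernel.comap_apply, P.lintegral_labelKernel]

end ActiveStrategy

/-- A problem whose labels are fair coins. Its history laws serve as reference measures. -/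
def fairProblem (d : ℕ) : Problem d where
  PX := Measure.dirac (fun _ => 0, 0)
  isProb := inferInstance
  η := fun _ => 1 / 2
  measurable_η := measurable_const
  η_mem := fun _ => by norm_num

theorem fairProblem_labelProb (x : Feature d) (y : Bool) :
    (fairProblem d).labelProb x y = 1 / 2 := by
  cases y <;> norm_num [Problem.labelProb, fairProblem]

namespace Problem

/-- The likelihood ratio of a history between the problem `P` and fair labels. -/
def likelihood (P : Problem d) {t : ℕ} (h : History d t) : ℝ :=
  ∏ s, (2 * P.labelProb (h s).1 (h s).2)

theorem likelihood_nonneg (P : Problem d) {t : ℕ} (h : History d t) : 0 ≤ P.likelihood h :=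
  Finset.prod_nonneg fun _ _ => mul_nonneg zero_le_two (P.labelProb_nonneg _ _)

theorem measurable_likelihood (P : Problem d) {t : ℕ} {Ω : Type*} [MeasurableSpace Ω] :
    Measurable fun p : Ω × History d t => P.likelihood p.2 :=
  Finset.measurable_prod _ fun s _ => (P.measurable_labelProb.comp
    ((measurable_pi_apply s).comp measurable_snd)).const_mul 2

theorem likelihood_extend (P : Problem d) (A : ActiveStrategy.{u} d n) {t : ℕ}
    (p : A.Seed × History d t) (y : Bool) :
    P.likelihood (A.extend t (p, y)).2
      = P.likelihood p.2 * (2 * P.labelProb (A.query t p) y) := by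
  simp only [likelihood, ActiveStrategy.extend, Fin.prod_univ_castSucc, Fin.snoc_castSucc,
    Fin.snoc_last]

end Problem

namespace ActiveStrategy

theorem law_eq_withDensity (A : ActiveStrategy.{u} d n) (P : Problem d) (t : ℕ) :
    A.law P t = (A.law (fairProblem d) t).withDensity
      fun p => ENNReal.ofReal (P.likelihood p.2) := by
  induction t with
  | zero => simp [Problem.likelihood, ActiveStrategy.law]
  | succ t ih =>
    have h_lik : ∀ t, Measurable fun p : A.Seed × History d t =>
        ENNReal.ofReal (P.likelihood p.2) := fun t => P.measurable_likelihood.ennreal_ofReal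
    refine Measure.ext_of_lintegral _ fun Φ hΦ => ?_
    have h_meas : Measurable fun p => ∑ y,
        ENNReal.ofReal (P.labelProb (A.query t p) y) * Φ (A.extend t (p, y)) :=
      Finset.measurable_sum _ fun y _ =>
        (P.measurable_labelProb.comp
          ((A.measurable_query t).prodMk measurable_const)).ennreal_ofReal.mul
        (hΦ.comp ((A.measurable_extend t).comp (measurable_id.prodMk measurable_const)))
    rw [lintegral_law_succ A P t hΦ, ih, lintegral_withDensity_eq_lintegral_mul _ (h_lik t) h_meas,
      lintegral_withDensity_eq_lintegral_mul _ (h_lik (t + 1)) hΦ,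
      lintegral_law_succ A _ t ((h_lik (t + 1)).mul hΦ)]
    refine lintegral_congr fun p => ?_
    simp only [Pi.mul_apply, Finset.mul_sum, ← mul_assoc, P.likelihood_extend,
      fairProblem_labelProb, ← ENNReal.ofReal_mul (P.likelihood_nonneg _),
      ← ENNReal.ofReal_mul one_half_pos.le]
    refine Finset.sum_congr rfl fun y _ => ?_
    congr 2
    ring

theorem law_apply (A : ActiveStrategy.{u} d n) (P : Problem d) {t : ℕ}
    {T : Set (A.Seed × History d t)} (hT : MeasurableSet T) :
    A.law P t T = ∫⁻ p in T, ENNReal.ofReal (P.likelihood p.2) ∂(A.law (fairProblem d) t) := by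
  rw [law_eq_withDensity A P, withDensity_apply _ hT]

/-- The expected number of queries in `S` among the first `t`. -/
def expectedQueries (A : ActiveStrategy.{u} d n) (P : Problem d) (S : Set (Feature d))
    (t : ℕ) : ℝ≥0∞ :=
  ∑ s ∈ Finset.range t, A.law P s (A.query s ⁻¹' S)

theorem sum_expectedQueries_le {ι : Type*} [Fintype ι] (A : ActiveStrategy.{u} d n)
    (P : Problem d) {S : ι → Set (Feature d)} (hS : ∀ j, MeasurableSet (S j))
    (h_disj : Pairwise (Function.onFun Disjoint S)) (t : ℕ) :
    ∑ j, A.expectedQueries P (S j) t ≤ t := by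
  have h_step : ∀ s, ∑ j, A.law P s (A.query s ⁻¹' S j) ≤ 1 := fun s =>
    (sum_measure_le_measure_univ
      (fun j _ => (A.measurable_query s (hS j)).nullMeasurableSet)
      (fun _ _ _ _ hij => ((h_disj hij).preimage _).aedisjoint)).trans_eq measure_univ
  unfold expectedQueries
  rw [Finset.sum_comm]
  exact (Finset.sum_le_card_nsmul _ _ 1 fun s _ => h_step s).trans (by simp)

end ActiveStrategy

/-! ### Two-point bound -/

/-- The Hellinger affinity of the label laws of two problems at a point. -/
def hellingerAffinity (P Q : Problem d) (x : Feature d) : ℝ :=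
  ∑ y, √(P.labelProb x y * Q.labelProb x y)

theorem hellingerAffinity_of_eta_eq {P Q : Problem d} {x : Feature d} (h : P.η x = Q.η x) :
    hellingerAffinity P Q x = 1 := by
  have h_eq : ∀ y, Q.labelProb x y = P.labelProb x y := fun y => by simp only [Problem.labelProb, h]
  simp only [hellingerAffinity, h_eq, Real.sqrt_mul_self (P.labelProb_nonneg _ _)]
  simp [Problem.labelProb]

theorem one_sub_le_hellingerAffinity_of_eta_add_eq_one {P Q : Problem d} {x : Feature d}
    (h : P.η x + Q.η x = 1) : 1 - 4 * (P.η x - 1 / 2) ^ 2 ≤ hellingerAffinity P Q x := by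
  have hη := P.η_mem x
  have h_sqrt : 2 * (P.η x * (1 - P.η x)) ≤ √(P.η x * (1 - P.η x)) := by
    refine Real.le_sqrt_of_sq_le ?_
    have h_nonneg : 0 ≤ P.η x * (1 - P.η x) := mul_nonneg hη.1 (sub_nonneg.2 hη.2)
    have h_quarter : 4 * (P.η x * (1 - P.η x)) ≤ 1 := by linarith [sq_nonneg (1 - 2 * P.η x)]
    linarith [mul_le_mul_of_nonneg_left h_quarter h_nonneg]
  have h_aff : hellingerAffinity P Q x = √(P.η x * (1 - P.η x)) + √(P.η x * (1 - P.η x)) := by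
    simp [hellingerAffinity, Problem.labelProb, eq_sub_of_add_eq' h, mul_comm (1 - P.η x)]
  rw [h_aff]
  linarith

theorem sqrt_mul_le_half_add {a b : ℝ} (hab : 0 ≤ a + b) : √(a * b) ≤ (a + b) / 2 :=
  Real.sqrt_le_iff.2 ⟨by positivity, by linarith [sq_nonneg (a - b)]⟩

theorem lintegral_sqrt_mul_le {Ω : Type*} [MeasurableSpace Ω] {μ : Measure Ω} {f g : Ω → ℝ}
    (hf : ∀ x, 0 ≤ f x) (hg : ∀ x, 0 ≤ g x) (hf_meas : Measurable f) (hg_meas : Measurable g) :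
    ∫⁻ x, ENNReal.ofReal √(f x * g x) ∂μ
      ≤ ∫⁻ x, ENNReal.ofReal (f x) ∂μ + ENNReal.ofReal (1 / 4) * ∫⁻ x, ENNReal.ofReal (g x) ∂μ := by
  rw [← lintegral_const_mul _ hg_meas.ennreal_ofReal,
    ← lintegral_add_left hf_meas.ennreal_ofReal]
  refine lintegral_mono fun x => ?_
  have hfx := hf x
  have hgx := hg x
  rw [← ENNReal.ofReal_mul (by norm_num), ← ENNReal.ofReal_add hfx (by positivity)]
  refine ENNReal.ofReal_le_ofReal ?_
  calc √(f x * g x) = √(2 * f x * (g x / 2)) := by ring_nf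
    _ ≤ f x + 1 / 4 * g x := by
        linarith [sqrt_mul_le_half_add (show 0 ≤ 2 * f x + g x / 2 by positivity)]

namespace ActiveStrategy

/-- The Hellinger affinity of the laws, on two problems, of the first `t` steps of a strategy. -/
def affinity (A : ActiveStrategy.{u} d n) (P Q : Problem d) (t : ℕ) : ℝ≥0∞ :=
  ∫⁻ p, ENNReal.ofReal √(P.likelihood p.2 * Q.likelihood p.2) ∂(A.law (fairProblem d) t)

theorem affinity_succ (A : ActiveStrategy.{u} d n) (P Q : Problem d) (t : ℕ) :
    A.affinity P Q (t + 1) = ∫⁻ p, ENNReal.ofReal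
      (√(P.likelihood p.2 * Q.likelihood p.2) * hellingerAffinity P Q (A.query t p))
      ∂(A.law (fairProblem d) t) := by
  rw [affinity, lintegral_law_succ A _ t
    (P.measurable_likelihood.fun_mul Q.measurable_likelihood).sqrt.ennreal_ofReal]
  refine lintegral_congr fun p => ?_
  rw [hellingerAffinity, Finset.mul_sum,
    ENNReal.ofReal_sum_of_nonneg fun _ _ => mul_nonneg (Real.sqrt_nonneg _) (Real.sqrt_nonneg _)]
  refine Finset.sum_congr rfl fun y _ => ?_
  have hLL := mul_nonneg (P.likelihood_nonneg p.2) (Q.likelihood_nonneg p.2)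
  have h_factor : P.likelihood (A.extend t (p, y)).2 * Q.likelihood (A.extend t (p, y)).2
      = 2 ^ 2 * (P.likelihood p.2 * Q.likelihood p.2 *
        (P.labelProb (A.query t p) y * Q.labelProb (A.query t p) y)) := by
    rw [P.likelihood_extend, Q.likelihood_extend]
    ring
  rw [fairProblem_labelProb, h_factor, Real.sqrt_mul (sq_nonneg _), Real.sqrt_sq zero_le_two,
    Real.sqrt_mul hLL, ← ENNReal.ofReal_mul one_half_pos.le]
  congr 1
  ring

variable (A : ActiveStrategy.{u} d n) {P Q : Problem d} {S : Set (Feature d)} {δ : ℝ}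

theorem affinity_le_affinity_succ_add (hS : MeasurableSet S) (hδ : 0 ≤ δ)
    (h_aff : ∀ x, 1 - S.indicator (fun _ => δ) x ≤ hellingerAffinity P Q x) (t : ℕ) :
    A.affinity P Q t ≤ A.affinity P Q (t + 1) + ENNReal.ofReal (δ / 2) *
      (A.law P t (A.query t ⁻¹' S) + A.law Q t (A.query t ⁻¹' S)) := by
  have hT := A.measurable_query t hS
  have hP : Measurable fun p : A.Seed × History d t => ENNReal.ofReal (P.likelihood p.2) :=
    P.measurable_likelihood.ennreal_ofReal
  have hQ : Measurable fun p : A.Seed × History d t => ENNReal.ofReal (Q.likelihood p.2) :=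
    Q.measurable_likelihood.ennreal_ofReal
  rw [affinity_succ, law_apply A P hT, law_apply A Q hT, ← lintegral_add_left hP,
    ← lintegral_const_mul _ (hP.fun_add hQ), ← lintegral_indicator hT,
    ← lintegral_add_right _ (((hP.fun_add hQ).const_mul _).indicator hT)]
  refine lintegral_mono fun p => ?_
  have hP0 := P.likelihood_nonneg p.2
  have hQ0 := Q.likelihood_nonneg p.2
  have h_loss := mul_le_mul_of_nonneg_left (h_aff (A.query t p))
    (Real.sqrt_nonneg (P.likelihood p.2 * Q.likelihood p.2))
  by_cases hp : A.query t p ∈ S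
  · simp only [indicator_of_mem hp] at h_loss
    simp only [indicator_of_mem (show p ∈ A.query t ⁻¹' S from hp)]
    rw [← ENNReal.ofReal_add hP0 hQ0, ← ENNReal.ofReal_mul (by positivity)]
    refine (ENNReal.ofReal_le_ofReal ?_).trans ENNReal.ofReal_add_le
    linarith [mul_le_mul_of_nonneg_left (sqrt_mul_le_half_add (add_nonneg hP0 hQ0)) hδ]
  · simp only [indicator_of_notMem hp, sub_zero, mul_one] at h_loss
    exact le_add_right (ENNReal.ofReal_le_ofReal h_loss)

theorem one_le_affinity_add (hS : MeasurableSet S) (hδ : 0 ≤ δ)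
    (h_aff : ∀ x, 1 - S.indicator (fun _ => δ) x ≤ hellingerAffinity P Q x) (t : ℕ) :
    1 ≤ A.affinity P Q t
      + ENNReal.ofReal (δ / 2) * (A.expectedQueries P S t + A.expectedQueries Q S t) := by
  induction t with
  | zero => simp [affinity, Problem.likelihood]
  | succ t ih =>
    simp only [expectedQueries, Finset.sum_range_succ] at ih ⊢
    refine (ih.trans (add_le_add_left
      (A.affinity_le_affinity_succ_add hS hδ h_aff t) _)).trans_eq ?_
    ring

theorem setLIntegral_sqrt_likelihood_le (P Q : Problem d) {t : ℕ}
    {T : Set (A.Seed × History d t)} (hT : MeasurableSet T) :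
    ∫⁻ p in T, ENNReal.ofReal √(P.likelihood p.2 * Q.likelihood p.2) ∂(A.law (fairProblem d) t)
      ≤ A.law P t T + ENNReal.ofReal (1 / 4) := by
  have h_meas : ∀ R : Problem d, Measurable fun p : A.Seed × History d t => R.likelihood p.2 :=
    fun R => R.measurable_likelihood
  refine (lintegral_sqrt_mul_le (fun p => P.likelihood_nonneg _) (fun p => Q.likelihood_nonneg _)
    (h_meas P) (h_meas Q)).trans ?_
  rw [← law_apply A P hT, ← law_apply A Q hT]
  gcongr
  exact mul_le_of_le_one_right' prob_le_one

theorem affinity_le_law_add_law_compl {t : ℕ} {T : Set (A.Seed × History d t)}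
    (hT : MeasurableSet T) :
    A.affinity P Q t ≤ A.law P t T + A.law Q t Tᶜ + 1 / 2 := by
  calc A.affinity P Q t
      = ∫⁻ p in T, ENNReal.ofReal √(P.likelihood p.2 * Q.likelihood p.2)
            ∂(A.law (fairProblem d) t)
          + ∫⁻ p in Tᶜ, ENNReal.ofReal √(Q.likelihood p.2 * P.likelihood p.2)
            ∂(A.law (fairProblem d) t) := by
        simp only [mul_comm (Q.likelihood _)]
        exact (lintegral_add_compl _ hT).symm
    _ ≤ (A.law P t T + ENNReal.ofReal (1 / 4)) + (A.law Q t Tᶜ + ENNReal.ofReal (1 / 4)) :=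
        add_le_add (A.setLIntegral_sqrt_likelihood_le P Q hT)
          (A.setLIntegral_sqrt_likelihood_le Q P hT.compl)
    _ = A.law P t T + A.law Q t Tᶜ + (ENNReal.ofReal (1 / 4) + ENNReal.ofReal (1 / 4)) := by ring
    _ = A.law P t T + A.law Q t Tᶜ + 1 / 2 := by
        rw [← ENNReal.ofReal_add (by norm_num) (by norm_num)]
        norm_num [ENNReal.ofReal_div_of_pos]

end ActiveStrategy

end Histories

/-! ### Averaging over a cube of problems -/

section Cube

variable {ι : Type*} [DecidableEq ι]

/-- The neighbour of the vertex `σ` of the Boolean cube across the coordinate `j`. -/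
def flipBit (σ : ι → Bool) (j : ι) : ι → Bool :=
  Function.update σ j (!σ j)

theorem flipBit_self (σ : ι → Bool) (j : ι) : flipBit σ j j = !σ j :=
  Function.update_self ..

theorem flipBit_involutive (j : ι) : Function.Involutive fun σ : ι → Bool => flipBit σ j := by
  intro σ
  simp [flipBit]

variable [Fintype ι]

theorem sum_sum_flipBit (F : (ι → Bool) → ι → ℝ≥0∞) :
    ∑ σ, ∑ j, F (flipBit σ j) j = ∑ σ, ∑ j, F σ j := by
  rw [Finset.sum_comm, Finset.sum_comm (f := F)]
  exact Finset.sum_congr rfl fun j _ =>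
    Equiv.sum_comp (flipBit_involutive j).toPerm fun σ => F σ j

theorem sum_sum_le_card_mul {f : (ι → Bool) → ι → ℝ≥0∞} {b : ℝ≥0∞}
    (hf : ∀ σ, ∑ j, f σ j ≤ b) : ∑ σ, ∑ j, f σ j ≤ Fintype.card (ι → Bool) * b :=
  (Finset.sum_le_card_nsmul _ _ b fun σ _ => hf σ).trans_eq (by simp)

theorem card_div_eight_le_iSup_sum_of_flipBit {e N : (ι → Bool) → ι → ℝ≥0∞} {D B : ℝ≥0∞}
    (h_pair : ∀ σ j, 1 ≤ e σ j + e (flipBit σ j) j + 1 / 2 + D * (N σ j + N (flipBit σ j) j))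
    (hN : ∀ σ, ∑ j, N σ j ≤ B) (hB : 8 * (D * B) ≤ Fintype.card ι) :
    (Fintype.card ι : ℝ≥0∞) / 8 ≤ ⨆ σ, ∑ j, e σ j := by
  set m : ℝ≥0∞ := (Fintype.card ι : ℝ≥0∞)
  set s := ⨆ σ, ∑ j, e σ j
  have h_sum : ∑ _σ : ι → Bool, ∑ _j : ι, (1 : ℝ≥0∞) ≤ ∑ σ, ∑ j,
      (e σ j + e (flipBit σ j) j + 1 / 2 + D * (N σ j + N (flipBit σ j) j)) :=
    Finset.sum_le_sum fun σ _ => Finset.sum_le_sum fun j _ => h_pair σ j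
  simp only [Finset.sum_add_distrib, ← Finset.mul_sum, sum_sum_flipBit (fun σ j => N σ j),
    sum_sum_flipBit (fun σ j => e σ j), Finset.sum_const, Finset.card_univ, nsmul_eq_mul,
    mul_one] at h_sum
  have h_avg : m ≤ s + s + m * (1 / 2) + D * (B + B) := by
    refine (ENNReal.mul_le_mul_iff_right (a := Fintype.card (ι → Bool)) (by simp)
      (ENNReal.natCast_ne_top _)).1 (h_sum.trans ?_)
    set M : ℝ≥0∞ := (Fintype.card (ι → Bool) : ℝ≥0∞)
    have he : ∑ σ, ∑ j, e σ j ≤ M * s := sum_sum_le_card_mul (le_iSup fun σ => ∑ j, e σ j)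
    have hN' : ∑ σ, ∑ j, N σ j ≤ M * B := sum_sum_le_card_mul hN
    calc ∑ σ, ∑ j, e σ j + ∑ σ, ∑ j, e σ j + m * (M * (1 / 2))
          + D * (∑ σ, ∑ j, N σ j + ∑ σ, ∑ j, N σ j)
        ≤ M * s + M * s + m * (M * (1 / 2)) + D * (M * B + M * B) := by gcongr
      _ = M * (s + s + m * (1 / 2) + D * (B + B)) := by ring
  have h_half : (2 : ℝ≥0∞) * (1 / 2) = 1 := ENNReal.mul_div_cancel two_ne_zero ENNReal.ofNat_ne_top
  have h_bound : m * 6 + m * 2 ≤ m * 6 + s * 8 * 2 :=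
    calc m * 6 + m * 2 = 8 * m := by ring
      _ ≤ 8 * (s + s + m * (1 / 2) + D * (B + B)) := by gcongr
      _ = 8 * (s + s) + m * 4 * (2 * (1 / 2)) + 8 * (D * B) * 2 := by ring
      _ ≤ 8 * (s + s) + m * 4 * 1 + m * 2 := by rw [h_half]; gcongr
      _ = m * 6 + s * 8 * 2 := by ring
  have h_top : m * 6 ≠ ∞ := ENNReal.mul_ne_top (ENNReal.natCast_ne_top _) ENNReal.ofNat_ne_top
  exact ENNReal.div_le_of_le_mul ((ENNReal.mul_le_mul_iff_left two_ne_zero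
    ENNReal.ofNat_ne_top).1 ((ENNReal.add_le_add_iff_left h_top).1 h_bound))

end Cube

/-! ### Assouad's bound -/

section Assouad

variable {ι : Type*} [Fintype ι] {d n : ℕ}

theorem ActiveStrategy.measurable_classify_apply (A : ActiveStrategy.{u} d n)
    (h : A.Seed × History d n) : Measurable (A.classify h) :=
  A.measurable_classify.comp measurable_prodMk_left

theorem ActiveStrategy.measurableSet_classify_ne (A : ActiveStrategy.{u} d n) (z : Feature d)
    (s : Bool) : MeasurableSet {h | A.classify h z ≠ s} :=
  (A.measurable_classify.comp measurable_prodMk_right) (measurableSet_singleton s).compl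

theorem ActiveStrategy.mul_sum_law_ne_le_expectedExcessRisk (A : ActiveStrategy.{u} d n)
    (P : Problem d) (z : ι → Feature d) (s : ι → Bool) {v : ℝ} (hv : 0 ≤ v)
    (h_risk : ∀ f, Measurable f → v * ∑ j, (if f (z j) ≠ s j then 1 else 0) ≤ P.excessRisk f) :
    ENNReal.ofReal v * ∑ j, A.law P n {h | A.classify h (z j) ≠ s j}
      ≤ A.expectedExcessRisk P := by
  have h_meas := fun j => A.measurableSet_classify_ne (z j) (s j)
  have h_ind : ∀ j, Measurable fun h =>
      {h | A.classify h (z j) ≠ s j}.indicator (1 : A.Seed × History d n → ℝ≥0∞) h :=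
    fun j => measurable_one.indicator (h_meas j)
  simp_rw [← lintegral_indicator_one (h_meas _)]
  rw [← lintegral_finsetSum _ fun j _ => h_ind j,
    ← lintegral_const_mul _ (Finset.measurable_sum _ fun j _ => h_ind j)]
  refine lintegral_mono fun h => (le_of_eq ?_).trans
    (ENNReal.ofReal_le_ofReal (h_risk _ (A.measurable_classify_apply h)))
  rw [ENNReal.ofReal_mul hv, ENNReal.ofReal_sum_of_nonneg fun _ _ => by positivity]
  congr 1
  refine Finset.sum_congr rfl fun j _ => ?_
  by_cases hj : A.classify h (z j) = s j <;> simp [hj]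

theorem ofReal_mul_le_iSup_expectedExcessRisk [DecidableEq ι] (A : ActiveStrategy.{u} d n)
    (P : (ι → Bool) → Problem d) {S : ι → Set (Feature d)} (hS : ∀ j, MeasurableSet (S j))
    (h_disj : Pairwise (Function.onFun Disjoint S)) (z : ι → Feature d) {δ v : ℝ} (hδ : 0 ≤ δ)
    (hv : 0 ≤ v)
    (h_aff : ∀ σ j x, 1 - (S j).indicator (fun _ => δ) x
      ≤ hellingerAffinity (P σ) (P (flipBit σ j)) x)
    (h_risk : ∀ σ f, Measurable f →
      v * ∑ j, (if f (z j) ≠ σ j then 1 else 0) ≤ (P σ).excessRisk f)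
    (hn : 4 * δ * n ≤ Fintype.card ι) :
    ENNReal.ofReal v * (Fintype.card ι / 8) ≤ ⨆ σ, A.expectedExcessRisk (P σ) := by
  have h_pair : ∀ σ j, 1 ≤ A.law (P σ) n {h | A.classify h (z j) ≠ σ j}
      + A.law (P (flipBit σ j)) n {h | A.classify h (z j) ≠ flipBit σ j j} + 1 / 2
      + ENNReal.ofReal (δ / 2) * (A.expectedQueries (P σ) (S j) n
        + A.expectedQueries (P (flipBit σ j)) (S j) n) := by
    intro σ j
    have h_compl : {h | A.classify h (z j) ≠ flipBit σ j j}
        = {h | A.classify h (z j) ≠ σ j}ᶜ := by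
      ext h
      simp [flipBit_self]
    rw [h_compl]
    exact (A.one_le_affinity_add (hS j) hδ (h_aff σ j) n).trans (add_le_add_left
      (A.affinity_le_law_add_law_compl (A.measurableSet_classify_ne (z j) (σ j))) _)
  have h_budget : 8 * (ENNReal.ofReal (δ / 2) * (n : ℝ≥0∞)) ≤ Fintype.card ι := by
    rw [← ENNReal.ofReal_natCast, ← ENNReal.ofReal_natCast, ← ENNReal.ofReal_mul (by positivity),
      ← ENNReal.ofReal_ofNat, ← ENNReal.ofReal_mul (by positivity)]
    exact ENNReal.ofReal_le_ofReal (by linarith)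
  calc ENNReal.ofReal v * (Fintype.card ι / 8)
      ≤ ENNReal.ofReal v * ⨆ σ, ∑ j, A.law (P σ) n {h | A.classify h (z j) ≠ σ j} := by
        gcongr
        exact card_div_eight_le_iSup_sum_of_flipBit h_pair
          (fun σ => A.sum_expectedQueries_le (P σ) hS h_disj n) h_budget
    _ ≤ ⨆ σ, A.expectedExcessRisk (P σ) := by
        rw [ENNReal.mul_iSup]
        exact iSup_mono fun σ =>
          A.mul_sum_law_ne_le_expectedExcessRisk (P σ) z σ hv (h_risk σ)

end Assouad

/-! ### Excess risk -/

namespace Problem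

variable {d : ℕ} (P : Problem d) {f : Feature d → Bool}

theorem labelKernel_apply_ne (x : Feature d) (s : Bool) :
    P.labelKernel x {y | y ≠ s} = ENNReal.ofReal (P.labelProb x !s) := by
  rw [← lintegral_indicator_one ({y | y ≠ s}.toFinite.measurableSet), P.lintegral_labelKernel]
  cases s <;> simp

theorem measurable_labelProb_not (hf : Measurable f) :
    Measurable fun x => P.labelProb x !f x :=
  P.measurable_labelProb.comp (measurable_id.prodMk ((Measurable.of_discrete (f := not)).comp hf))

theorem integrable_labelProb_not (hf : Measurable f) :
    Integrable (fun x => P.labelProb x !f x) P.PX := by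
  have := P.isProb
  refine Integrable.of_mem_Icc 0 1 (P.measurable_labelProb_not hf).aemeasurable
    (ae_of_all _ fun x => ⟨P.labelProb_nonneg _ _, ?_⟩)
  have hη := P.η_mem x
  cases f x
  · exact hη.2
  · exact sub_le_self _ hη.1

theorem risk_eq_integral_labelProb (hf : Measurable f) :
    P.risk f = ∫ x, P.labelProb x !f x ∂P.PX := by
  have := P.isProb
  have h_set : MeasurableSet {z : Feature d × Bool | z.2 ≠ f z.1} :=
    (measurableSet_eq_fun measurable_snd (hf.comp measurable_fst)).compl
  rw [risk, joint, measureReal_def, Measure.compProd_apply h_set,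
    integral_eq_lintegral_of_nonneg_ae (ae_of_all _ fun x => P.labelProb_nonneg _ _)
      (P.measurable_labelProb_not hf).aestronglyMeasurable]
  exact congrArg _ (lintegral_congr fun x => P.labelKernel_apply_ne x (f x))

theorem measurable_bayes : Measurable P.bayes := by
  refine measurable_to_bool ?_
  simpa only [bayes, preimage, mem_singleton_iff, decide_eq_true_eq] using
    measurableSet_le measurable_const P.measurable_η

theorem labelProb_not_sub_labelProb_not_bayes (x : Feature d) (s : Bool) :
    P.labelProb x (!s) - P.labelProb x (!P.bayes x)
      = if s ≠ P.bayes x then |1 - 2 * P.η x| else 0 := by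
  rcases le_or_gt (1 / 2) (P.η x) with h | h
  · rw [show P.bayes x = true by simpa [bayes] using h, abs_of_nonpos (by linarith)]
    cases s <;> simp [labelProb]
    ring
  · rw [show P.bayes x = false by simpa [bayes] using h, abs_of_pos (by linarith)]
    cases s <;> simp [labelProb]
    ring

theorem excessRisk_eq_integral (hf : Measurable f) :
    P.excessRisk f = ∫ x, (if f x ≠ P.bayes x then |1 - 2 * P.η x| else 0) ∂P.PX := by
  simp_rw [← labelProb_not_sub_labelProb_not_bayes]
  rw [excessRisk, P.risk_eq_integral_labelProb hf, P.risk_eq_integral_labelProb P.measurable_bayes,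
    integral_sub (P.integrable_labelProb_not hf) (P.integrable_labelProb_not P.measurable_bayes)]

end Problem

/-! ### Discrete laws -/

section DiscreteLaw

variable {Ω ι : Type*} [MeasurableSpace Ω] [Fintype ι]

/-- The law that puts mass `1 - w` on `x₀` and spreads the mass `w` evenly over the points `z j`. -/
def spreadLaw (w : ℝ) (x₀ : Ω) (z : ι → Ω) : Measure Ω :=
  ENNReal.ofReal (1 - w) • Measure.dirac x₀
    + ∑ j, ENNReal.ofReal (w / Fintype.card ι) • Measure.dirac (z j)

variable {w : ℝ} (hw : w ∈ Icc (0 : ℝ) 1) (x₀ : Ω) (z : ι → Ω)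
include hw

theorem isProbabilityMeasure_spreadLaw [Nonempty ι] : IsProbabilityMeasure (spreadLaw w x₀ z) := by
  have h_card : (Fintype.card ι : ℝ) * (w / Fintype.card ι) = w :=
    mul_div_cancel₀ _ (Nat.cast_ne_zero.2 Fintype.card_ne_zero)
  refine ⟨?_⟩
  simp only [spreadLaw, Measure.coe_add, Measure.coe_smul, Pi.add_apply, Pi.smul_apply,
    smul_eq_mul, measure_univ, mul_one, Measure.finsetSum_apply, Finset.sum_const,
    Finset.card_univ, nsmul_eq_mul]
  rw [← ENNReal.ofReal_natCast, ← ENNReal.ofReal_mul (Nat.cast_nonneg _), h_card,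
    ← ENNReal.ofReal_add (sub_nonneg.2 hw.2) hw.1, sub_add_cancel, ENNReal.ofReal_one]

theorem integral_spreadLaw [MeasurableSingletonClass Ω] (F : Ω → ℝ) :
    ∫ x, F x ∂(spreadLaw w x₀ z) = (1 - w) * F x₀ + w / Fintype.card ι * ∑ j, F (z j) := by
  have h_int : ∀ x, Integrable F (Measure.dirac x) := fun x => integrable_dirac (by simp)
  rw [spreadLaw, integral_add_measure ((h_int _).smul_measure ENNReal.ofReal_ne_top)
    (integrable_finsetSum_measure.2 fun j _ => (h_int _).smul_measure ENNReal.ofReal_ne_top),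
    integral_finsetSum_measure fun j _ => (h_int _).smul_measure ENNReal.ofReal_ne_top]
  simp only [integral_smul_measure, integral_dirac, smul_eq_mul]
  rw [ENNReal.toReal_ofReal (sub_nonneg.2 hw.2),
    ENNReal.toReal_ofReal (div_nonneg hw.1 (Nat.cast_nonneg _)), Finset.mul_sum]

end DiscreteLaw

/-! ### The grid of problems -/

theorem continuous_tilde {d : ℕ} : Continuous (Feature.tilde : Feature d → Fin (d - 1) → ℝ) :=
  continuous_pi fun i => continuous_subtype_val.comp ((continuous_apply i).comp continuous_fst)

theorem continuous_last {d : ℕ} : Continuous (Feature.last : Feature d → ℝ) :=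
  continuous_subtype_val.comp continuous_snd

/-- The parameters of the family of hard problems: the number `K` of cells per axis, the level `b`
and the height `h` of the bumps of the boundary, and the mass `w` of the marginal law at level
`b`. -/
structure GridParam (d : ℕ) (c κ : ℝ) where
  K : ℕ
  b : ℝ
  h : ℝ
  w : ℝ
  K_pos : 0 < K
  c_pos : 0 < c
  one_le_κ : 1 ≤ κ
  half_le_b : 1 / 2 ≤ b
  b_le_one : b ≤ 1
  h_pos : 0 < h
  noise_le : c * (b + 2 * h) ^ (κ - 1) ≤ 1 / 2
  w_mem : w ∈ Icc (0 : ℝ) 1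

namespace GridParam

variable {d : ℕ} {c κ : ℝ} (G : GridParam d c κ)

/-- The indices of the cells of the grid. -/
abbrev Cell : Type := Fin (d - 1) → Fin G.K

instance : Nonempty G.Cell := ⟨fun _ => ⟨0, G.K_pos⟩⟩

/-- The point at level `b` above the centre of a cell. -/
def point (j : G.Cell) : Feature d :=
  (fun i => ⟨((j i : ℝ) + 1 / 2) / G.K, by
    have h : ((j i : ℕ) : ℝ) + 1 ≤ G.K := by exact_mod_cast (j i).2
    exact ⟨by positivity, div_le_one_of_le₀ (by linarith) (Nat.cast_nonneg _)⟩⟩,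
    ⟨G.b, one_half_pos.le.trans G.half_le_b, G.b_le_one⟩)

theorem smul_tilde_point (j : G.Cell) : (G.K : ℝ) • (G.point j).tilde = cellCenter j :=
  funext fun _ => mul_div_cancel₀ _ (Nat.cast_ne_zero.2 G.K_pos.ne')

theorem last_point (j : G.Cell) : (G.point j).last = G.b := rfl

/-- The boundary with label `σ j` at the point above the cell `j`. -/
def boundary (σ : G.Cell → Bool) : (Fin (d - 1) → ℝ) → ℝ :=
  bumpBoundary G.b G.h σ

theorem abs_boundary_sub_le (σ : G.Cell → Bool) (x : Fin (d - 1) → ℝ) :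
    |G.boundary σ x - G.b| ≤ G.h :=
  abs_bumpBoundary_sub_le G.h_pos.le x

theorem boundary_point (σ : G.Cell → Bool) (j : G.Cell) :
    G.boundary σ (G.point j).tilde = G.b + G.h * cellSign (σ j) :=
  bumpBoundary_of_smul_eq_cellCenter (G.smul_tilde_point j)

theorem abs_last_sub_boundary_point (σ : G.Cell → Bool) (j : G.Cell) :
    |(G.point j).last - G.boundary σ (G.point j).tilde| = G.h := by
  rw [boundary_point, last_point, sub_add_cancel_left, abs_neg, abs_mul, abs_cellSign, mul_one,
    abs_of_pos G.h_pos]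

theorem measurable_boundary_tilde (σ : G.Cell → Bool) :
    Measurable fun x : Feature d => G.boundary σ x.tilde :=
  ((contDiff_bumpBoundary (n := 0)).continuous.comp continuous_tilde).measurable

/-- The distance of the regression functions from `1/2` at the height `y`. All boundaries lie
within `h` of the level `b`, so the offset `2h` makes it independent of the boundary and still
large enough for the noise condition. -/
def margin (y : ℝ) : ℝ := c * (|y - G.b| + 2 * G.h) ^ (κ - 1)

theorem margin_b : G.margin G.b = c * (2 * G.h) ^ (κ - 1) := by simp [margin]

theorem margin_pos (y : ℝ) : 0 < G.margin y :=
  mul_pos G.c_pos (Real.rpow_pos_of_pos (add_pos_of_nonneg_of_pos (abs_nonneg _)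
    (mul_pos two_pos G.h_pos)) _)

theorem margin_le {y r : ℝ} (hy : |y - G.b| ≤ r) : G.margin y ≤ c * (r + 2 * G.h) ^ (κ - 1) := by
  have hh := G.h_pos
  have hκ := sub_nonneg.2 G.one_le_κ
  have hc := G.c_pos
  unfold margin
  gcongr

theorem le_margin {y r : ℝ} (hr : 0 ≤ r) (hy : r ≤ |y - G.b| + 2 * G.h) :
    c * r ^ (κ - 1) ≤ G.margin y :=
  mul_le_mul_of_nonneg_left (Real.rpow_le_rpow hr hy (sub_nonneg.2 G.one_le_κ)) G.c_pos.le

theorem margin_last_le_half (x : Feature d) : G.margin x.last ≤ 1 / 2 := by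
  have h_mem : x.last ∈ Icc (0 : ℝ) 1 := x.2.2
  exact (G.margin_le (abs_le.2 ⟨by linarith [h_mem.1], by linarith [h_mem.2, G.half_le_b]⟩)).trans
    G.noise_le

/-- The problem with boundary `G.boundary σ`. The marginal law, which charges only the grid points
and the origin, does not depend on `σ`. -/
def problem (σ : G.Cell → Bool) : Problem d where
  PX := spreadLaw G.w 0 G.point
  isProb := isProbabilityMeasure_spreadLaw G.w_mem 0 G.point
  η x := if G.boundary σ x.tilde ≤ x.last then 1 / 2 + G.margin x.last else 1 / 2 - G.margin x.last
  measurable_η := by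
    have h_margin : Measurable fun x : Feature d => G.margin x.last := by
      have := (continuous_last (d := d)).measurable
      unfold margin
      fun_prop
    exact Measurable.ite (measurableSet_le (G.measurable_boundary_tilde σ)
      continuous_last.measurable) (measurable_const.add h_margin) (measurable_const.sub h_margin)
  η_mem x := by
    have h_pos := G.margin_pos x.last
    have h_half := G.margin_last_le_half x
    split_ifs <;> constructor <;> linarith

variable (σ : G.Cell → Bool)

theorem eta_of_boundary_le {x : Feature d} (hx : G.boundary σ x.tilde ≤ x.last) :
    (G.problem σ).η x = 1 / 2 + G.margin x.last :=
  if_pos hx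

theorem eta_of_lt_boundary {x : Feature d} (hx : x.last < G.boundary σ x.tilde) :
    (G.problem σ).η x = 1 / 2 - G.margin x.last :=
  if_neg hx.not_ge

theorem half_le_eta_iff (x : Feature d) :
    1 / 2 ≤ (G.problem σ).η x ↔ G.boundary σ x.tilde ≤ x.last := by
  have h_pos := G.margin_pos x.last
  rcases le_or_gt (G.boundary σ x.tilde) x.last with hx | hx
  · simp [G.eta_of_boundary_le σ hx, hx, h_pos.le]
  · simp [G.eta_of_lt_boundary σ hx, hx.not_ge, h_pos.not_ge]

theorem abs_eta_sub_half (x : Feature d) : |(G.problem σ).η x - 1 / 2| = G.margin x.last := by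
  rcases le_or_gt (G.boundary σ x.tilde) x.last with hx | hx
  · rw [G.eta_of_boundary_le σ hx, add_sub_cancel_left, abs_of_pos (G.margin_pos _)]
  · rw [G.eta_of_lt_boundary σ hx, sub_sub_cancel_left, abs_neg, abs_of_pos (G.margin_pos _)]

theorem abs_one_sub_two_mul_eta_point (j : G.Cell) :
    |1 - 2 * (G.problem σ).η (G.point j)| = 2 * (c * (2 * G.h) ^ (κ - 1)) := by
  rw [← margin_b, ← last_point G j, ← G.abs_eta_sub_half σ, abs_sub_comm,
    ← abs_of_pos (zero_lt_two' ℝ), ← abs_mul, abs_of_pos (zero_lt_two' ℝ)]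
  ring_nf

theorem bayes_point (j : G.Cell) : (G.problem σ).bayes (G.point j) = σ j := by
  have hh := G.h_pos
  rw [Bool.eq_iff_iff, Problem.bayes, decide_eq_true_iff, half_le_eta_iff, boundary_point,
    last_point]
  cases σ j <;> simp [cellSign, hh, hh.le]

theorem integral_problem_PX (F : Feature d → ℝ) : ∫ x, F x ∂(G.problem σ).PX
    = (1 - G.w) * F 0 + G.w / Fintype.card G.Cell * ∑ j, F (G.point j) :=
  integral_spreadLaw G.w_mem 0 G.point F

theorem le_excessRisk_problem {f : Feature d → Bool} (hf : Measurable f) :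
    G.w * (2 * (c * (2 * G.h) ^ (κ - 1))) / Fintype.card G.Cell
      * ∑ j, (if f (G.point j) ≠ σ j then 1 else 0) ≤ (G.problem σ).excessRisk f := by
  rw [Problem.excessRisk_eq_integral _ hf, integral_problem_PX]
  simp only [bayes_point, abs_one_sub_two_mul_eta_point]
  calc G.w * (2 * (c * (2 * G.h) ^ (κ - 1))) / Fintype.card G.Cell
        * ∑ j, (if f (G.point j) ≠ σ j then 1 else 0)
      = G.w / Fintype.card G.Cell
        * ∑ j, (if f (G.point j) ≠ σ j then 2 * (c * (2 * G.h) ^ (κ - 1)) else 0) := by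
        rw [mul_div_right_comm, mul_assoc, Finset.mul_sum]
        simp only [mul_ite, mul_one, mul_zero]
    _ ≤ _ := le_add_of_nonneg_left (mul_nonneg (sub_nonneg.2 G.w_mem.2) (by positivity))

/-- The points within vertical distance `Δ` of the boundary. -/
def strip (Δ : ℝ) : Set (Feature d) := {x | |x.last - G.boundary σ x.tilde| ≤ Δ}

theorem measurableSet_strip (Δ : ℝ) : MeasurableSet (G.strip σ Δ) :=
  measurableSet_le
    (continuous_last.measurable.sub (G.measurable_boundary_tilde σ)).abs measurable_const

theorem point_mem_strip_iff (Δ : ℝ) (j : G.Cell) : G.point j ∈ G.strip σ Δ ↔ G.h ≤ Δ := by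
  rw [strip, mem_ofPred_eq, abs_last_sub_boundary_point]

theorem zero_notMem_strip {Δ : ℝ} (hΔ : Δ < G.b - G.h) : (0 : Feature d) ∉ G.strip σ Δ := by
  intro h_mem
  have h_strip := (abs_le.1 (mem_ofPred.1 h_mem)).1
  have h_bound := (abs_le.1 (G.abs_boundary_sub_le σ (0 : Feature d).tilde)).1
  have h_last : (0 : Feature d).last = 0 := rfl
  linarith

theorem setIntegral_strip_le {C κ' Δ : ℝ} (hC : 0 ≤ C) (hκ' : 0 ≤ κ')
    (h_mass : G.w * (2 * (c * (2 * G.h) ^ (κ - 1))) ≤ C * G.h ^ κ') (hΔ : 0 ≤ Δ)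
    (hΔ_lt : Δ < G.b - G.h) :
    ∫ x in G.strip σ Δ, |1 - 2 * (G.problem σ).η x| ∂(G.problem σ).PX ≤ C * Δ ^ κ' := by
  have h_card : (Fintype.card G.Cell : ℝ) ≠ 0 := Nat.cast_ne_zero.2 Fintype.card_ne_zero
  have h_int : ∫ x in G.strip σ Δ, |1 - 2 * (G.problem σ).η x| ∂(G.problem σ).PX
      = if G.h ≤ Δ then G.w * (2 * (c * (2 * G.h) ^ (κ - 1))) else 0 := by
    rw [← integral_indicator (G.measurableSet_strip σ Δ), integral_problem_PX,
      indicator_of_notMem (G.zero_notMem_strip σ hΔ_lt)]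
    simp only [indicator, point_mem_strip_iff, abs_one_sub_two_mul_eta_point, Finset.sum_const,
      Finset.card_univ, nsmul_eq_mul]
    split_ifs
    · field_simp
      ring
    · simp
  rw [h_int]
  split_ifs with h
  · exact h_mass.trans (mul_le_mul_of_nonneg_left (Real.rpow_le_rpow G.h_pos.le h hκ') hC)
  · positivity

theorem problem_mem_problemClass {lam α C κ' Δ₀ : ℝ} (hC : 0 ≤ C) (hκ' : 0 ≤ κ')
    (h_holder : IsHolder lam α (G.boundary σ)) (hΔ₀ : Δ₀ < G.b - G.h)
    (h_mass : G.w * (2 * (c * (2 * G.h) ^ (κ - 1))) ≤ C * G.h ^ κ') :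
    G.problem σ ∈ problemClass d lam α c κ C Δ₀ κ' := by
  refine ⟨G.boundary σ, h_holder, ext fun x => G.half_le_eta_iff σ x, fun x => ?_,
    fun Δ hΔ => G.setIntegral_strip_le σ hC hκ' h_mass hΔ.1 (hΔ.2.trans_lt hΔ₀)⟩
  have h_tri := abs_sub_le x.last G.b (G.boundary σ x.tilde)
  have h_bound := G.abs_boundary_sub_le σ x.tilde
  rw [abs_sub_comm] at h_bound
  rw [abs_eta_sub_half]
  exact G.le_margin (abs_nonneg _) (by linarith [G.h_pos])

/-- The part of the feature space above the support of the bump in a cell. -/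
def column (j : G.Cell) : Set (Feature d) :=
  (fun x => (G.K : ℝ) • x.tilde) ⁻¹' Metric.ball (cellCenter j) (cellBump (d - 1)).rOut

theorem measurableSet_column (j : G.Cell) : MeasurableSet (G.column j) := by
  have h_cont : Continuous fun x : Feature d => (G.K : ℝ) • x.tilde :=
    continuous_tilde.const_smul (G.K : ℝ)
  exact h_cont.measurable measurableSet_ball

theorem pairwise_disjoint_column : Pairwise (Function.onFun Disjoint G.column) := by
  intro i j hij
  have h_disj := pairwise_disjoint_closedBall_cellCenter (d - 1) G.K hij
  exact (h_disj.mono Metric.ball_subset_closedBall Metric.ball_subset_closedBall).preimage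
    fun x : Feature d => (G.K : ℝ) • x.tilde

variable {σ} {τ : G.Cell → Bool} {x : Feature d}

theorem eta_flipBit_of_notMem_column {j : G.Cell} (hx : x ∉ G.column j) :
    (G.problem (flipBit σ j)).η x = (G.problem σ).η x := by
  have h_boundary : G.boundary (flipBit σ j) x.tilde = G.boundary σ x.tilde :=
    bumpBoundary_update j (!σ j) hx
  simp only [problem, h_boundary]

theorem eta_add_eta_eq_one (hστ : (G.problem σ).η x ≠ (G.problem τ).η x) :
    (G.problem σ).η x + (G.problem τ).η x = 1 := by
  simp only [problem] at hστ ⊢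
  split_ifs at hστ ⊢ <;> first | exact absurd rfl hστ | ring

theorem abs_last_sub_b_le (hστ : (G.problem σ).η x ≠ (G.problem τ).η x) :
    |x.last - G.b| ≤ G.h := by
  have hσ := abs_le.1 (G.abs_boundary_sub_le σ x.tilde)
  have hτ := abs_le.1 (G.abs_boundary_sub_le τ x.tilde)
  by_contra! h_far
  refine hστ ?_
  rcases lt_abs.1 h_far with h_above | h_below
  · rw [G.eta_of_boundary_le σ (by linarith), G.eta_of_boundary_le τ (by linarith)]
  · rw [G.eta_of_lt_boundary σ (by linarith), G.eta_of_lt_boundary τ (by linarith)]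

theorem one_sub_le_hellingerAffinity (σ τ : G.Cell → Bool) (x : Feature d) :
    1 - 4 * (c * (3 * G.h) ^ (κ - 1)) ^ 2 ≤ hellingerAffinity (G.problem σ) (G.problem τ) x := by
  by_cases hστ : (G.problem σ).η x = (G.problem τ).η x
  · rw [hellingerAffinity_of_eta_eq hστ]
    exact sub_le_self _ (by positivity)
  · refine le_trans ?_ (one_sub_le_hellingerAffinity_of_eta_add_eq_one (G.eta_add_eta_eq_one hστ))
    have h_margin := G.margin_le (G.abs_last_sub_b_le hστ)
    rw [← G.abs_eta_sub_half σ, show G.h + 2 * G.h = 3 * G.h by ring] at h_margin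
    rw [← sq_abs ((G.problem σ).η x - 1 / 2)]
    gcongr

theorem one_sub_indicator_le_hellingerAffinity (σ : G.Cell → Bool) (j : G.Cell) (x : Feature d) :
    1 - (G.column j).indicator (fun _ => 4 * (c * (3 * G.h) ^ (κ - 1)) ^ 2) x
      ≤ hellingerAffinity (G.problem σ) (G.problem (flipBit σ j)) x := by
  by_cases hx : x ∈ G.column j
  · rw [indicator_of_mem hx]
    exact G.one_sub_le_hellingerAffinity σ _ x
  · rw [indicator_of_notMem hx, sub_zero,
      hellingerAffinity_of_eta_eq (G.eta_flipBit_of_notMem_column hx).symm]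

theorem le_minimaxRisk {lam α C κ' Δ₀ : ℝ} {n : ℕ} (hC : 0 ≤ C) (hκ' : 0 ≤ κ')
    (h_holder : ∀ σ, IsHolder lam α (G.boundary σ)) (hΔ₀ : Δ₀ < G.b - G.h)
    (h_mass : G.w * (2 * (c * (2 * G.h) ^ (κ - 1))) ≤ C * G.h ^ κ')
    (hn : 16 * (c * (3 * G.h) ^ (κ - 1)) ^ 2 * n ≤ (G.K : ℝ) ^ (d - 1)) :
    ENNReal.ofReal (G.w * (2 * (c * (2 * G.h) ^ (κ - 1))) / 8)
      ≤ minimaxRisk.{u} n (problemClass d lam α c κ C Δ₀ κ') := by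
  set v := G.w * (2 * (c * (2 * G.h) ^ (κ - 1)))
  have hv : 0 ≤ v / Fintype.card G.Cell := by
    have hc := G.c_pos
    have hh := G.h_pos
    have hw := G.w_mem.1
    positivity
  have h_card : (Fintype.card G.Cell : ℝ) = (G.K : ℝ) ^ (d - 1) := by simp
  refine le_iInf fun A => ?_
  calc ENNReal.ofReal (v / 8)
      = ENNReal.ofReal (v / Fintype.card G.Cell) * (Fintype.card G.Cell / 8) := by
        rw [← ENNReal.ofReal_natCast, ← ENNReal.ofReal_ofNat,
          ← ENNReal.ofReal_div_of_pos (by norm_num), ← ENNReal.ofReal_mul hv]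
        field_simp
    _ ≤ ⨆ σ, (A (spreadLaw G.w 0 G.point)).expectedExcessRisk (G.problem σ) :=
        ofReal_mul_le_iSup_expectedExcessRisk _ G.problem G.measurableSet_column
          G.pairwise_disjoint_column G.point (by positivity) hv
          G.one_sub_indicator_le_hellingerAffinity (fun σ _ hf => G.le_excessRisk_problem σ hf)
          (by rw [h_card]; linarith)
    _ ≤ ⨆ P ∈ problemClass d lam α c κ C Δ₀ κ', (A P.PX).expectedExcessRisk P :=
        iSup_le fun σ => le_iSup₂_of_le (G.problem σ)
          (G.problem_mem_problemClass σ hC hκ' (h_holder σ) hΔ₀ h_mass) le_rfl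

end GridParam

/-! ### Choice of the parameters -/

theorem exists_height {a c κ A lam : ℝ} (hκ : 1 < κ) (hlam : 0 < lam) (ha : a < 1)
    (hca : c * a ^ (κ - 1) < 1 / 2) :
    ∃ h₀ > 0, ∀ h ∈ Ioc 0 h₀, a + 3 * h ≤ 1 ∧ c * (a + 4 * h) ^ (κ - 1) ≤ 1 / 2 ∧
      A * h ≤ lam ∧ 16 * (c * (3 * h) ^ (κ - 1)) ^ 2 ≤ 1 := by
  have hκ0 : 0 < κ - 1 := sub_pos.2 hκ
  have h_near : ∀ {F : ℝ → ℝ} {r : ℝ}, Continuous F → F 0 < r →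
      ∀ᶠ h in nhdsWithin (0 : ℝ) (Ioi 0), F h ≤ r := fun hF h_lt =>
    ((hF.tendsto 0).eventually_le_const h_lt).filter_mono nhdsWithin_le_nhds
  have h_rpow : Continuous fun y : ℝ => y ^ (κ - 1) := Real.continuous_rpow_const hκ0.le
  have h_level := h_near (F := fun h => a + 3 * h) (r := 1) (by fun_prop) (by simpa using ha)
  have h_noise := h_near (F := fun h => c * (a + 4 * h) ^ (κ - 1)) (r := 1 / 2)
    ((h_rpow.comp (by fun_prop)).const_mul c) (by simpa using hca)
  have h_holder := h_near (F := fun h => A * h) (r := lam) (by fun_prop) (by simpa using hlam)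
  have h_info := h_near (F := fun h => 16 * (c * (3 * h) ^ (κ - 1)) ^ 2) (r := 1)
    ((((h_rpow.comp (by fun_prop)).const_mul c).pow 2).const_mul 16)
    (by simp [Real.zero_rpow hκ0.ne'])
  exact mem_nhdsGT_iff_exists_Ioc_subset.1
    (h_level.and (h_noise.and (h_holder.and h_info)))

theorem exists_mass {c κ κ' v h : ℝ} (hc : 0 < c) (hκ' : κ - 1 ≤ κ') (hv : 0 ≤ v)
    (hv_le : v ≤ 2 * (c * 2 ^ (κ - 1))) (hh : h ∈ Ioc (0 : ℝ) 1) :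
    ∃ w ∈ Icc (0 : ℝ) 1, w * (2 * (c * (2 * h) ^ (κ - 1))) = v * h ^ κ' := by
  have hh0 := hh.1
  have h_pos : 0 < 2 * (c * (2 * h) ^ (κ - 1)) := by positivity
  refine ⟨v * h ^ κ' / (2 * (c * (2 * h) ^ (κ - 1))), ⟨by positivity, (div_le_one h_pos).2 ?_⟩,
    div_mul_cancel₀ _ h_pos.ne'⟩
  calc v * h ^ κ' ≤ 2 * (c * 2 ^ (κ - 1)) * h ^ (κ - 1) := by
        exact mul_le_mul hv_le (Real.rpow_le_rpow_of_exponent_ge hh0 hh.2 hκ') (by positivity)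
          (by positivity)
    _ = 2 * (c * (2 * h) ^ (κ - 1)) := by
        rw [Real.mul_rpow zero_le_two hh0.le]
        ring

theorem exists_nat_rpow_bounds {e : ℝ} (he : 0 < e) {n : ℕ} (hn : 1 ≤ n) :
    ∃ K : ℕ, 0 < K ∧ (n : ℝ) ≤ (K : ℝ) ^ e ∧ (K : ℝ) ≤ 2 * (n : ℝ) ^ e⁻¹ := by
  have h_one : 1 ≤ (n : ℝ) ^ e⁻¹ := Real.one_le_rpow (Nat.one_le_cast.2 hn) (by positivity)
  refine ⟨⌈(n : ℝ) ^ e⁻¹⌉₊, Nat.ceil_pos.2 (by positivity), ?_, ?_⟩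
  · calc (n : ℝ) = ((n : ℝ) ^ e⁻¹) ^ e := (Real.rpow_inv_rpow (Nat.cast_nonneg n) he.ne').symm
      _ ≤ _ := by gcongr; exact Nat.le_ceil _
  · linarith [Nat.ceil_lt_add_one (zero_le_one.trans h_one)]

section MinimaxRisk

variable {d : ℕ} {lam α c κ C₃ Δ₀ κ' : ℝ}

theorem le_minimaxRisk_of_height {a v h : ℝ} {K n : ℕ} (hc : 0 < c) (hκ : 1 ≤ κ)
    (hκ' : κ - 1 ≤ κ') (hv : 0 ≤ v) (hv_le : v ≤ 2 * (c * 2 ^ (κ - 1))) (hvC : v ≤ C₃)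
    (ha : 1 / 2 ≤ a) (hΔa : Δ₀ ≤ a) (hK : 0 < K) (hh : 0 < h) (h_level : a + 3 * h ≤ 1)
    (h_noise : c * (a + 4 * h) ^ (κ - 1) ≤ 1 / 2)
    (h_holder : ∀ σ : (Fin (d - 1) → Fin K) → Bool,
      IsHolder lam α (bumpBoundary (a + 2 * h) h σ))
    (hn : 16 * (c * (3 * h) ^ (κ - 1)) ^ 2 * n ≤ (K : ℝ) ^ (d - 1)) :
    ENNReal.ofReal (v / 8 * h ^ κ')
      ≤ minimaxRisk.{u} n (problemClass d lam α c κ C₃ Δ₀ κ') := by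
  obtain ⟨w, hw, h_mass⟩ := exists_mass hc hκ' hv hv_le ⟨hh, by linarith⟩
  -- The level `a + 2h` keeps every boundary above `a + h > Δ₀`, so no strip contains the origin.
  let G : GridParam d c κ :=
    { K := K, b := a + 2 * h, h := h, w := w, K_pos := hK, c_pos := hc, one_le_κ := hκ,
      half_le_b := by linarith, b_le_one := by linarith, h_pos := hh,
      noise_le := by convert h_noise using 3; ring
      w_mem := hw }
  have h_risk := G.le_minimaxRisk (n := n) (hv.trans hvC) ((sub_nonneg.2 hκ).trans hκ') h_holder
    (show Δ₀ < a + 2 * h - h by linarith)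
    (h_mass.trans_le (mul_le_mul_of_nonneg_right hvC (by positivity))) hn
  simpa only [G, h_mass, div_mul_eq_mul_div] using h_risk

theorem mul_natCast_le_pow_of_le_rpow {h₀ : ℝ} {K n : ℕ} (hd : 1 ≤ d) (hh₀ : 0 ≤ h₀) (hK : 0 < K)
    (h_info : 16 * (c * (3 * h₀) ^ (κ - 1)) ^ 2 ≤ 1)
    (hn : (n : ℝ) ≤ (K : ℝ) ^ (2 * α * (κ - 1) + d - 1)) :
    16 * (c * (3 * (h₀ * (K : ℝ) ^ (-α))) ^ (κ - 1)) ^ 2 * n ≤ (K : ℝ) ^ (d - 1) := by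
  have hK0 : (0 : ℝ) < K := Nat.cast_pos.2 hK
  have h_split : (3 * (h₀ * (K : ℝ) ^ (-α))) ^ (κ - 1)
      = (3 * h₀) ^ (κ - 1) * (K : ℝ) ^ (-α * (κ - 1)) := by
    rw [← mul_assoc, Real.mul_rpow (by positivity) (by positivity), ← Real.rpow_mul hK0.le]
  have h_exp : ((K : ℝ) ^ (-α * (κ - 1))) ^ 2 * (K : ℝ) ^ (2 * α * (κ - 1) + d - 1)
      = (K : ℝ) ^ (d - 1) := by
    rw [← Real.rpow_natCast, ← Real.rpow_mul hK0.le, ← Real.rpow_add hK0, ← Real.rpow_natCast,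
      Nat.cast_sub hd]
    congr 1
    push_cast
    ring
  calc 16 * (c * (3 * (h₀ * (K : ℝ) ^ (-α))) ^ (κ - 1)) ^ 2 * n
      = 16 * (c * (3 * h₀) ^ (κ - 1)) ^ 2 * (((K : ℝ) ^ (-α * (κ - 1))) ^ 2 * n) := by
        rw [h_split]
        ring
    _ ≤ 1 * (((K : ℝ) ^ (-α * (κ - 1))) ^ 2 * (K : ℝ) ^ (2 * α * (κ - 1) + d - 1)) := by gcongr
    _ = (K : ℝ) ^ (d - 1) := by rw [one_mul, h_exp]

theorem exists_le_minimaxRisk_of_le_rpow (hd : 1 ≤ d) (hlam : 0 < lam) (hα : 0 < α) (hc : 0 < c)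
    (hκ : 1 < κ) (hκ' : κ - 1 ≤ κ') (hC₃ : 0 < C₃) (hΔ₀ : Δ₀ < 1)
    (hcΔ : c * (max (1 / 2) Δ₀) ^ (κ - 1) < 1 / 2) :
    ∃ C > 0, ∀ K n : ℕ, 0 < K → (n : ℝ) ≤ (K : ℝ) ^ (2 * α * (κ - 1) + d - 1) →
      ENNReal.ofReal (C * (K : ℝ) ^ (-(α * κ')))
        ≤ minimaxRisk.{u} n (problemClass d lam α c κ C₃ Δ₀ κ') := by
  obtain ⟨A, hA⟩ := exists_isHolder_bumpBoundary (d - 1) α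
  obtain ⟨h₀, hh₀, h_small⟩ := exists_height (A := A) hκ hlam (max_lt one_half_lt_one hΔ₀) hcΔ
  obtain ⟨-, -, h_holder, h_info⟩ := h_small h₀ (right_mem_Ioc.2 hh₀)
  set v := min C₃ (2 * (c * 2 ^ (κ - 1)))
  have hv : 0 < v := lt_min hC₃ (by positivity)
  refine ⟨v / 8 * h₀ ^ κ', by positivity, fun K n hK hn => ?_⟩
  have hK0 : (0 : ℝ) < K := Nat.cast_pos.2 hK
  have hK1 : (1 : ℝ) ≤ K := Nat.one_le_cast.2 hK
  set h := h₀ * (K : ℝ) ^ (-α) with hh_def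
  have hh : h ∈ Ioc 0 h₀ := ⟨by positivity,
    mul_le_of_le_one_right hh₀.le (Real.rpow_le_one_of_one_le_of_nonpos hK1 (by linarith))⟩
  obtain ⟨h_level, h_noise, -, -⟩ := h_small h hh
  have h_rate : v / 8 * h₀ ^ κ' * (K : ℝ) ^ (-(α * κ')) = v / 8 * h ^ κ' := by
    rw [hh_def, Real.mul_rpow hh₀.le (by positivity), ← Real.rpow_mul hK0.le]
    ring_nf
  rw [h_rate]
  refine le_minimaxRisk_of_height hc hκ.le hκ' hv.le (min_le_right _ _) (min_le_left _ _)
    (le_max_left _ _) (le_max_right _ _) hK hh.1 h_level h_noise (fun σ => ?_)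
    (mul_natCast_le_pow_of_le_rpow hd hh₀.le hK h_info hn)
  have h_scale : A * h * (K : ℝ) ^ α = A * h₀ := by
    rw [hh_def, mul_assoc, mul_assoc, ← Real.rpow_add hK0, neg_add_cancel, Real.rpow_zero, mul_one]
  exact hA lam K _ h σ hK hh.1.le (by linarith [le_max_left (1 / 2) Δ₀, hh.1])
    (by linarith) (h_scale.trans_le h_holder)

end MinimaxRisk

end

end ActiveLearning

theorem theorem5_general (d : ℕ) (hd : 1 ≤ d) (lam α c κ C₃ Δ₀ κ' : ℝ)
    (hlam : 0 < lam) (hα : 0 < α) (hc : 0 < c) (hκ : 1 < κ) (hκ' : κ - 1 ≤ κ')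
    (hC₃ : 0 < C₃) (hΔ₀_lt : Δ₀ < 1) (hcΔ : c * (max (1 / 2) Δ₀) ^ (κ - 1) < 1 / 2) :
    ∃ C : ℝ, 0 < C ∧ ∀ n : ℕ, 1 ≤ n →
      ENNReal.ofReal (C * (n : ℝ) ^ (-(α * κ') / (2 * α * (κ - 1) + (d : ℝ) - 1))) ≤
        ActiveLearning.minimaxRisk.{u} n
          (ActiveLearning.problemClass d lam α c κ C₃ Δ₀ κ') := by
  obtain ⟨C, hC, h_risk⟩ := ActiveLearning.exists_le_minimaxRisk_of_le_rpow.{u} hd hlam hα hc hκ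
    hκ' hC₃ hΔ₀_lt hcΔ
  set e := 2 * α * (κ - 1) + (d : ℝ) - 1
  have he : 0 < e := by
    have h_mul : 0 < 2 * α * (κ - 1) := mul_pos (mul_pos two_pos hα) (sub_pos.2 hκ)
    have h_dim : (1 : ℝ) ≤ d := Nat.one_le_cast.2 hd
    linarith
  have h_neg : -(α * κ') ≤ 0 :=
    neg_nonpos.2 (mul_nonneg hα.le ((sub_pos.2 hκ).le.trans hκ'))
  refine ⟨C * 2 ^ (-(α * κ')), by positivity, fun n hn => ?_⟩
  obtain ⟨K, hK, hnK, hKn⟩ := ActiveLearning.exists_nat_rpow_bounds he hn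
  refine (ENNReal.ofReal_le_ofReal ?_).trans (h_risk K n hK hnK)
  calc C * 2 ^ (-(α * κ')) * (n : ℝ) ^ (-(α * κ') / e)
      = C * (2 * (n : ℝ) ^ e⁻¹) ^ (-(α * κ')) := by
        rw [Real.mul_rpow zero_le_two (by positivity), ← Real.rpow_mul (Nat.cast_nonneg n),
          inv_mul_eq_div, mul_assoc]
    _ ≤ C * (K : ℝ) ^ (-(α * κ')) := mul_le_mul_of_nonneg_left
        (Real.rpow_le_rpow_of_nonpos (Nat.cast_pos.2 hK) hKn h_neg) hC.le

theorem theorem5 (d : ℕ) (hd : 2 ≤ d) (lam α c κ C₃ Δ₀ κ' : ℝ)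
    (hlam : 1 ≤ lam) (hα : 0 < α) (hc : 0 < c) (hκ : 1 < κ) (hκ' : κ - 1 < κ')
    (hC₃ : 0 < C₃) (hΔ₀ : 0 < Δ₀) (hΔ₀_lt : Δ₀ < 1)
    (hcΔ : c * (max (1 / 2) Δ₀) ^ (κ - 1) < 1 / 2) :
    ∃ C : ℝ, 0 < C ∧ ∃ N : ℕ, ∀ n : ℕ, N ≤ n →
      ENNReal.ofReal (C * (n : ℝ) ^ (-(α * κ') / (2 * α * (κ - 1) + (d : ℝ) - 1))) ≤
        ActiveLearning.minimaxRisk.{u} n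
          (ActiveLearning.problemClass d lam α c κ C₃ Δ₀ κ') := by
  obtain ⟨C, hC, h_risk⟩ := theorem5_general d (one_le_two.trans hd) lam α c κ C₃ Δ₀ κ'
    (one_pos.trans_le hlam) hα hc hκ hκ'.le hC₃ hΔ₀_lt hcΔ
  exact ⟨C, hC, 1, h_risk⟩
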